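/- **Setting.** Let $P$ be a probability measure on $[0,1]\times[-M,M]$, the law of $(X,Y)$. Let $G_X$ denote the marginal law of $X$, assumed known and without atoms, and also its (continuous) distribution function. Let $f(x)=\mathbb E(Y\mid X=x)$ be the regression function, and let $\mathbf z=\{(x_i,y_i)\}_{i\le n}$ be an i.i.d. sample from $P$. Write $\|\cdot\|$ for the norm of $L^2(G_X)$. **Warped wavelets.** Let $\varphi,\psi:\mathbb R\to\mathbb R$ be bounded, measurable, compactly supported functions such that the 1-periodised functions $\psi_{-1}(y)=\sum_{l\in\mathbb Z}\varphi(y+l)$ and $\psi_{j,k}(y)=\sum_{l\in\mathbb Z}2^{j/2}\psi(2^j(y+l)-k)$, $j\ge 0$, $0\le k<2^j$, form an orthonormal basis of $L^2([0,1],dy)$. For an index $I$ (either $-1$ or $(j,k)$) put $$d_I=\langle f,\psi_I(G_X)\rangle_{L^2(G_X)},\qquad d_I(\mathbf z)=\frac1n\sum_{i=1}^n y_i\,\psi_I(G_X(x_i)).$$ **Trees.** Identify $(j,k)$, $0\le k<2^j$, with the dyadic interval $[2^{-j}k,2^{-j}(k+1)]$; its children $\mathcal C(I)$ are its two halves. A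 tree is a set of nodes that contains, with each node, all its ancestors. The outer leaves of a finite tree $\mathcal T$ are the nodes outside $\mathcal T$ whose parent is in $\mathcal T$ (for the empty tree, the only outer leaf is the root). Let $\overline{\mathcal T}$ be $\mathcal T$ together with its outer leaves, and put $$\Pi_{\mathcal T}f=d_{-1}\psi_{-1}(G_X)+\sum_{I\in\overline{\mathcal T}}d_I\psi_I(G_X).$$ Let $\mathcal T_J$ be the tree of all nodes of level $<J$. The residuals are $$\nu_I=\Big(\sum_{I'\in\mathcal C(I)}d_{I'}^2\Big)^{1/2},\qquad \nu_I(\mathbf z)=\Big(\sum_{I'\in\mathcal C(I)}d_{I'}(\mathbf z)^2\Big)^{1/2}.$$ For $\lambda>0$, let $\mathcal T(f,\lambda)$ be the set of nodes that contain a node $I$ with $\nu_I\ge\lambda$. **Approximation spaces.** $f\in\mathcal A^\gamma$ means $f\in L^2(G_X)$ and $\sup_{J\ge0}2^{J\gamma}\|f-\Pi_{\mathcal T_J}f\|<\infty$. $f\in\mathcal B^s$ means $f\in L^2(G_X)$ and $\sup_{\lambda>0}\lambda^p\,\mathrm{card}\,\mathcal T(f,\lambda)<\infty$, where $p=(s+\frac12)^{-1}$.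 **Estimator.** For $\kappa>0$ let $\lambda_n=\kappa\sqrt{\log n/n}$, and let $J^\star$ be the largest $j\in\mathbb N_0$ with $2^j\le\lambda_n^{-1/\gamma}$ ($J^\star=0$ if there is none). Let $\mathcal T(\mathbf z,n)$ be the set $\{I\in\mathcal T_{J^\star}:\nu_I(\mathbf z)\ge\lambda_n\}$ completed to a tree by adding all ancestors, and let $$f_{\mathbf z}=d_{-1}(\mathbf z)\psi_{-1}(G_X)+\sum_{I\in\overline{\mathcal T(\mathbf z,n)}}d_I(\mathbf z)\psi_I(G_X).$$ **Theorem 2 (Optimality for "growing" adaptive partitions).** Fix $\varphi,\psi$ and $M$ as above, and let $\beta\in\mathbb R$ and $\gamma\ge\frac12$ be arbitrary. There exists $\kappa>0$ such that for every $P$ as above and every $s>0$ with $f\in\mathcal A^\gamma\cap\mathcal B^s$ there are constants $\tilde c,C>0$, not depending on $n$, such that for all $n\ge2$ $$P^{\otimes n}\Big\{\|f-f_{\mathbf z}\|>\tilde c\Big(\frac{\log n}{n}\Big)^{\frac{s}{2s+1}}\Big\}\le C\,n^{-\beta},\qquad \mathbb E^{\otimes n}\|f-f_{\mathbf z}\|^2\le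 C\Big(\frac{\log n}{n}\Big)^{\frac{2s}{2s+1}}.$$ The estimator is adaptive: neither $\kappa$ nor $f_{\mathbf z}$ depends on $s$. -/

import Mathlib

open MeasureTheory ProbabilityTheory
open scoped ENNReal

noncomputable section

namespace WarpedWavelet

/-! ### Dyadic nodes and trees

The node `(j, k)` with `k < 2 ^ j` stands for the dyadic interval `[2⁻ʲ k, 2⁻ʲ (k + 1)]`. -/

/-- The two children (halves) of a dyadic interval. -/
def children (p : ℕ × ℕ) : Finset (ℕ × ℕ) :=
  {(p.1 + 1, 2 * p.2), (p.1 + 1, 2 * p.2 + 1)}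

/-- `IsBelow q p`: the dyadic interval `q` is contained in the dyadic interval `p`. -/
def IsBelow (q p : ℕ × ℕ) : Prop :=
  p.1 ≤ q.1 ∧ q.2 / 2 ^ (q.1 - p.1) = p.2

/-- The tree of all nodes of level `< J`. -/
def levelTree (J : ℕ) : Finset (ℕ × ℕ) :=
  (Finset.range J ×ˢ Finset.range (2 ^ J)).filter fun p => p.2 < 2 ^ p.1

/-- The outer leaves of a finite tree `T`: the nodes outside `T` whose parent is in `T`.
The only outer leaf of the empty tree is the root. They form the dyadic partition
associated with `T`. -/
def outerLeaves (T : Finset (ℕ × ℕ)) : Finset (ℕ × ℕ) :=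
  insert (0, 0) (T.biUnion children) \ T

/-! ### Wavelets on `[0,1]` -/

/-- The `1`-periodised wavelet system. The index `none` is the scaling function, and
`some (j, k)` is the wavelet `2^{j/2} ψ(2ʲ y - k)`. For compactly supported `φ`, `ψ` all
the sums have finitely many nonzero terms. -/
def wavelet (φ ψ : ℝ → ℝ) : Option (ℕ × ℕ) → ℝ → ℝ
  | none, y => ∑' l : ℤ, φ (y + l)
  | some p, y => ∑' l : ℤ, (2 : ℝ) ^ ((p.1 : ℝ) / 2) * ψ ((2 : ℝ) ^ p.1 * (y + l) - p.2)

/-- The indices that occur: the scaling function and the wavelets with `0 ≤ k < 2 ^ j`. -/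
def IsIndex : Option (ℕ × ℕ) → Prop
  | none => True
  | some p => p.2 < 2 ^ p.1

/-- `φ` and `ψ` are bounded, compactly supported, and generate an orthonormal wavelet
basis of `L²([0,1], dy)`. -/
structure IsWaveletBasis (φ ψ : ℝ → ℝ) : Prop where
  measurable_scaling : Measurable φ
  measurable_mother : Measurable ψ
  bounded_scaling : ∃ B : ℝ, ∀ y, |φ y| ≤ B
  bounded_mother : ∃ B : ℝ, ∀ y, |ψ y| ≤ B
  compact_scaling : HasCompactSupport φ
  compact_mother : HasCompactSupport ψ
  orthonormal : ∀ a b, IsIndex a → IsIndex b →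
    ∫ y in Set.Icc (0 : ℝ) 1, wavelet φ ψ a y * wavelet φ ψ b y = if a = b then 1 else 0
  complete : ∀ h : ℝ → ℝ, MemLp h 2 (volume.restrict (Set.Icc (0 : ℝ) 1)) →
    (∀ a, IsIndex a → ∫ y in Set.Icc (0 : ℝ) 1, h y * wavelet φ ψ a y = 0) →
    h =ᵐ[volume.restrict (Set.Icc (0 : ℝ) 1)] 0

/-- The warped system `x ↦ ψ_a(G(x))`, where `G` is the distribution function of `μ`. -/
def warped (φ ψ : ℝ → ℝ) (μ : Measure ℝ) (a : Option (ℕ × ℕ)) (x : ℝ) : ℝ :=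
  wavelet φ ψ a (cdf μ x)

/-! ### Tree-structured expansions and approximation spaces -/

/-- The warped expansion with coefficients `d` on the partition associated with `T`: the
scaling term, and all wavelets attached to intervals that contain a cell of the partition,
that is, to the nodes of `T` and its outer leaves. -/
def treeSum (φ ψ : ℝ → ℝ) (μ : Measure ℝ) (d : Option (ℕ × ℕ) → ℝ) (T : Finset (ℕ × ℕ))
    (x : ℝ) : ℝ :=
  d none * warped φ ψ μ none x +
    ∑ p ∈ T ∪ outerLeaves T, d (some p) * warped φ ψ μ (some p) x

/-- The residual of a node: the `ℓ²` energy that the expansion gains when it is refined. -/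
def residual (d : Option (ℕ × ℕ) → ℝ) (p : ℕ × ℕ) : ℝ :=
  Real.sqrt (∑ q ∈ children p, d (some q) ^ 2)

/-- The coefficients of `f` in the warped basis, `⟨f, ψ_a(G)⟩` in `L²(μ)`. -/
def coeff (φ ψ : ℝ → ℝ) (μ : Measure ℝ) (f : ℝ → ℝ) (a : Option (ℕ × ℕ)) : ℝ :=
  ∫ x, f x * warped φ ψ μ a x ∂μ

/-- The tree `𝒯(f, lam)`: all nodes that contain a node with residual at least `lam`. -/
def residualTree (φ ψ : ℝ → ℝ) (μ : Measure ℝ) (f : ℝ → ℝ) (lam : ℝ) : Set (ℕ × ℕ) :=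
  {p | ∃ q : ℕ × ℕ, q.2 < 2 ^ q.1 ∧ IsBelow q p ∧ lam ≤ residual (coeff φ ψ μ f) q}

/-- The approximation space `𝒜^γ` (uniform partitions). -/
def MemA (φ ψ : ℝ → ℝ) (μ : Measure ℝ) (γ : ℝ) (f : ℝ → ℝ) : Prop :=
  MemLp f 2 μ ∧ ∃ M₀ : ℝ, ∀ J : ℕ,
    eLpNorm (fun x => f x - treeSum φ ψ μ (coeff φ ψ μ f) (levelTree J) x) 2 μ
      ≤ ENNReal.ofReal (M₀ * (2 : ℝ) ^ (-(J * γ)))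

/-- The approximation space `ℬ^s` (adaptive partitions):
`sup_{lam > 0} lam ^ p * card 𝒯(f, lam) < ∞` with `p = (s + 1/2)⁻¹`. -/
def MemB (φ ψ : ℝ → ℝ) (μ : Measure ℝ) (s : ℝ) (f : ℝ → ℝ) : Prop :=
  MemLp f 2 μ ∧ ∃ C : ℝ, ∀ lam : ℝ, 0 < lam →
    (residualTree φ ψ μ f lam).Finite ∧
      lam ^ (s + 1 / 2)⁻¹ * ((residualTree φ ψ μ f lam).ncard : ℝ) ≤ C

/-! ### The estimator -/

/-- The empirical coefficients `d_a(z) = n⁻¹ ∑ᵢ yᵢ ψ_a(G(xᵢ))`. -/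
def empCoeff (φ ψ : ℝ → ℝ) (μ : Measure ℝ) {n : ℕ} (z : Fin n → ℝ × ℝ)
    (a : Option (ℕ × ℕ)) : ℝ :=
  (n : ℝ)⁻¹ * ∑ i, (z i).2 * warped φ ψ μ a (z i).1

/-- The threshold `κ √(log n / n)`. -/
def threshold (κ : ℝ) (n : ℕ) : ℝ := κ * Real.sqrt (Real.log n / n)

/-- The largest `j` with `2 ^ j ≤ lam ^ (-1/γ)` (and `0` if there is none). -/
def truncLevel (γ lam : ℝ) : ℕ := sSup {j : ℕ | (2 : ℝ) ^ j ≤ lam ^ (-1 / γ)}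

open Classical in
/-- The empirical tree: the nodes of level `< J` whose residual is at least `lam`, completed
to a tree by all their ancestors. -/
def empTree (φ ψ : ℝ → ℝ) (μ : Measure ℝ) {n : ℕ} (z : Fin n → ℝ × ℝ) (lam : ℝ) (J : ℕ) :
    Finset (ℕ × ℕ) :=
  (levelTree J).filter fun p =>
    ∃ q ∈ levelTree J, IsBelow q p ∧ lam ≤ residual (empCoeff φ ψ μ z) q

/-- The vertically thresholded warped wavelet estimator. -/
def estimator (φ ψ : ℝ → ℝ) (μ : Measure ℝ) (κ γ : ℝ) {n : ℕ} (z : Fin n → ℝ × ℝ) :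
    ℝ → ℝ :=
  treeSum φ ψ μ (empCoeff φ ψ μ z)
    (empTree φ ψ μ z (threshold κ n) (truncLevel γ (threshold κ n)))

/-- `f` is (a version of) the regression function `x ↦ E(Y | X = x)` for `(X, Y) ∼ P`. -/
def IsRegressionFunction (P : Measure (ℝ × ℝ)) (f : ℝ → ℝ) : Prop :=
  Measurable f ∧
    (fun z : ℝ × ℝ => f z.1) =ᵐ[P]
      P[(Prod.snd : ℝ × ℝ → ℝ) | MeasurableSpace.comap Prod.fst inferInstance]

end WarpedWavelet

end

/-!
For an atomless law `G_X`, the distribution function `G` pushes `G_X` forward to the uniform law,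
so the warped wavelets `ψ_I(G)` are orthonormal in `L²(G_X)`, and every risk is an `ℓ²` distance
between coefficient sequences. An empirical coefficient is an i.i.d. mean with bounded variance and
with summands of size `O(2^{j/2})`; since `γ ≥ 1/2`, the truncation level satisfies `2^{J⋆} ≲ λₙ⁻²`,
and Bernstein's inequality bounds by `n^{-b}` the probability that it misses its mean by `λₙ / 4`,
where `b` grows linearly with `κ`. Outside an event of probability `O(n^{1-b})` all the
coefficients up to level `J⋆` are therefore accurate to `λₙ / 4`.

On that event every empirical residual is within `λₙ / 2` of the true one. Hence the empirical tree
lies in `𝒯(f, λₙ / 2)`, whose cardinality `O(λₙ^{-p})` controls the variance, and every discarded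
node has true residual at most `3 λₙ / 2`, so by the layer-cake formula the discarded nodes carry
energy `O(λₙ^{2-p})`. The truncation bias is `O(λₙ)` by `f ∈ 𝒜^γ`. Off the event, a crude `O(n)`
bound on the loss is enough.
-/

namespace WarpedWavelet

/-! ### The distribution function of an atomless law -/

section Cdf

variable (μ : Measure ℝ) [IsProbabilityMeasure μ] [NullSingletonClass μ]

lemma continuous_cdf : Continuous (cdf μ) := by
  refine continuous_iff_continuousAt.2 fun x => ?_
  rw [(cdf μ).mono.continuousAt_iff_leftLim_eq_rightLim, StieltjesFunction.rightLim_eq]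
  have h : μ {x} = 0 := measure_singleton x
  rw [← measure_cdf μ, StieltjesFunction.measure_singleton, ENNReal.ofReal_eq_zero] at h
  exact le_antisymm ((cdf μ).mono.leftLim_le le_rfl) (sub_nonpos.1 h)

lemma measure_cdf_le (t : ℝ) : μ {x | cdf μ x ≤ t} = ENNReal.ofReal (min 1 t) := by
  rcases le_or_gt 1 t with ht | ht
  · have huniv : {x | cdf μ x ≤ t} = Set.univ :=
      Set.eq_univ_of_forall fun x => (cdf_le_one μ x).trans ht
    simp [huniv, ht]
  rw [min_eq_right ht.le]
  obtain ⟨b, hb⟩ := ((tendsto_cdf_atTop μ).eventually (lt_mem_nhds ht)).exists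
  have hbdd : BddAbove {x | cdf μ x ≤ t} :=
    ⟨b, fun x hx => ((cdf μ).mono.reflect_lt (lt_of_le_of_lt hx hb)).le⟩
  have hclosed : IsClosed {x | cdf μ x ≤ t} := isClosed_le (continuous_cdf μ) continuous_const
  rcases Set.eq_empty_or_nonempty {x | cdf μ x ≤ t} with hempty | hne
  · have ht0 : t ≤ 0 := ge_of_tendsto (tendsto_cdf_atBot μ) <| .of_forall fun x =>
      (not_le.1 (Set.eq_empty_iff_forall_notMem.1 hempty x)).le
    simp [hempty, ENNReal.ofReal_of_nonpos ht0]
  · obtain ⟨x₀, hx₀, hmax⟩ : ∃ x₀, IsGreatest {x | cdf μ x ≤ t} x₀ :=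
      ⟨_, hclosed.isGreatest_csSup hne hbdd⟩
    obtain ⟨x₁, hx₁⟩ := mem_range_of_exists_le_of_exists_ge (continuous_cdf μ)
      ⟨x₀, hx₀⟩ ⟨b, hb.le⟩
    have hIic : {x | cdf μ x ≤ t} = Set.Iic x₀ :=
      Set.Subset.antisymm hmax fun x hx => ((cdf μ).mono hx).trans hx₀
    have hcdf : cdf μ x₀ = t := le_antisymm hx₀ (hx₁ ▸ (cdf μ).mono (hmax hx₁.le))
    rw [hIic, ← ofReal_cdf, hcdf]

lemma map_cdf : μ.map (cdf μ) = volume.restrict (Set.Icc (0 : ℝ) 1) := by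
  have hm : Measurable (cdf μ) := (continuous_cdf μ).measurable
  have : IsProbabilityMeasure (μ.map (cdf μ)) := Measure.isProbabilityMeasure_map hm.aemeasurable
  refine Measure.ext_of_Iic _ _ fun t => ?_
  have hcap : Set.Iic t ∩ Set.Icc 0 1 = Set.Icc 0 (min 1 t) := by
    ext x
    simp only [Set.mem_inter_iff, Set.mem_Iic, Set.mem_Icc, le_min_iff]
    tauto
  rw [Measure.map_apply hm measurableSet_Iic, Measure.restrict_apply measurableSet_Iic, hcap,
    Real.volume_Icc, sub_zero]
  exact measure_cdf_le μ t

end Cdf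

/-! ### Periodised and warped wavelets -/

/-- The level of an index. The scaling function is given level `0`, so that `2 ^ (level a / 2)`
is the amplitude of every member of the system. -/
def level : Option (ℕ × ℕ) → ℕ
  | none => 0
  | some p => p.1

/-- An orthonormal, not necessarily complete, periodised wavelet system with bounded, compactly
supported generators: what warping by a distribution function turns into an orthonormal system
of `L²(G_X)`. -/
structure IsOrthonormalWavelet (φ ψ : ℝ → ℝ) : Prop where
  measurable_scaling : Measurable φ
  measurable_mother : Measurable ψ
  bounded_scaling : ∃ B : ℝ, ∀ y, |φ y| ≤ B
  bounded_mother : ∃ B : ℝ, ∀ y, |ψ y| ≤ B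
  compact_scaling : HasCompactSupport φ
  compact_mother : HasCompactSupport ψ
  orthonormal : ∀ a b, IsIndex a → IsIndex b →
    ∫ y in Set.Icc (0 : ℝ) 1, wavelet φ ψ a y * wavelet φ ψ b y = if a = b then 1 else 0

/-- The properties of the warped system `x ↦ ψ_a(G(x))` that the estimator relies on: it is
orthonormal in `L²(μ)`, and its members of level `j` are bounded by `B * 2 ^ (j / 2)`. -/
structure IsWarpedSystem (φ ψ : ℝ → ℝ) (μ : Measure ℝ) (B : ℝ) : Prop where
  measurable : ∀ a, Measurable (warped φ ψ μ a)
  abs_le : ∀ a, IsIndex a → ∀ x, |warped φ ψ μ a x| ≤ B * (2 : ℝ) ^ ((level a : ℝ) / 2)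
  orthonormal : ∀ a b, IsIndex a → IsIndex b →
    ∫ x, warped φ ψ μ a x * warped φ ψ μ b x ∂μ = if a = b then 1 else 0

lemma IsWaveletBasis.isOrthonormalWavelet {φ ψ : ℝ → ℝ} (h : IsWaveletBasis φ ψ) :
    IsOrthonormalWavelet φ ψ :=
  { h with }

lemma exists_abs_tsum_translate_le {g : ℝ → ℝ} {C : ℝ} (hg : HasCompactSupport g)
    (hC : ∀ y, |g y| ≤ C) :
    ∃ B : ℝ, ∀ a k y : ℝ, 1 ≤ a → k ∈ Set.Icc 0 a → y ∈ Set.Icc (0 : ℝ) 1 →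
      |∑' l : ℤ, g (a * (y + l) - k)| ≤ B := by
  obtain ⟨R, hR⟩ := hg.isCompact.isBounded.exists_norm_le
  obtain ⟨N, hN⟩ := exists_nat_gt (R + 2)
  refine ⟨(Finset.Icc (-N : ℤ) N).card * C, fun a k y ha hk hy => ?_⟩
  have hzero : ∀ l ∉ Finset.Icc (-N : ℤ) N, g (a * (y + l) - k) = 0 := by
    intro l hl
    have hlarge : (N : ℝ) < |(l : ℝ)| := by
      rw [Finset.mem_Icc, ← abs_le, not_le] at hl
      exact_mod_cast hl
    by_contra hne
    have hsupp : |a * (y + l - k / a)| ≤ R := by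
      rw [mul_sub, mul_div_cancel₀ k (by positivity)]
      exact hR _ (subset_tsupport _ hne)
    have hka : k / a ∈ Set.Icc (0 : ℝ) 1 := ⟨div_nonneg hk.1 (by positivity),
      div_le_one_of_le₀ hk.2 (by positivity)⟩
    have hshift : |y + l - k / a| ≤ R := by
      rw [abs_mul, abs_of_pos (by positivity)] at hsupp
      exact (le_mul_of_one_le_left (abs_nonneg _) ha).trans hsupp
    have hl' : |(l : ℝ)| ≤ R + 1 := by
      rw [abs_le] at hshift ⊢
      constructor <;> linarith [hshift.1, hshift.2, hka.1, hka.2, hy.1, hy.2]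
    linarith
  rw [tsum_eq_sum hzero, ← nsmul_eq_mul]
  exact (Finset.abs_sum_le_sum_abs _ _).trans (Finset.sum_le_card_nsmul _ _ _ fun l _ => hC _)

namespace IsOrthonormalWavelet

variable {φ ψ : ℝ → ℝ}

lemma measurable_wavelet (h : IsOrthonormalWavelet φ ψ) (a : Option (ℕ × ℕ)) :
    Measurable (wavelet φ ψ a) := by
  cases a with
  | none => exact Measurable.tsum fun l => h.measurable_scaling.comp (by fun_prop)
  | some p =>
    exact Measurable.tsum fun l => (h.measurable_mother.comp (by fun_prop)).const_mul _

lemma exists_abs_wavelet_le (h : IsOrthonormalWavelet φ ψ) :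
    ∃ B : ℝ, 1 ≤ B ∧ ∀ a, IsIndex a → ∀ y ∈ Set.Icc (0 : ℝ) 1,
      |wavelet φ ψ a y| ≤ B * (2 : ℝ) ^ ((level a : ℝ) / 2) := by
  obtain ⟨B₁, hB₁⟩ := h.bounded_scaling.elim fun _ => exists_abs_tsum_translate_le h.compact_scaling
  obtain ⟨B₂, hB₂⟩ := h.bounded_mother.elim fun _ => exists_abs_tsum_translate_le h.compact_mother
  refine ⟨max 1 (max B₁ B₂), le_max_left _ _, fun a ha y hy => ?_⟩
  cases a with
  | none => simpa [wavelet, level] using Or.inr (Or.inl (hB₁ 1 0 y le_rfl (by simp) hy))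
  | some p =>
    have hp : (p.2 : ℝ) ∈ Set.Icc 0 ((2 : ℝ) ^ p.1) := ⟨p.2.cast_nonneg, by exact_mod_cast ha.le⟩
    have hsum := hB₂ _ _ y (one_le_pow₀ one_le_two) hp hy
    rw [wavelet, tsum_mul_left, abs_mul, abs_of_pos (by positivity), mul_comm, level]
    gcongr
    exact hsum.trans ((le_max_right _ _).trans (le_max_right _ _))

lemma exists_isWarpedSystem (h : IsOrthonormalWavelet φ ψ) :
    ∃ B : ℝ, 1 ≤ B ∧ ∀ (μ : Measure ℝ) [IsProbabilityMeasure μ] [NullSingletonClass μ],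
      IsWarpedSystem φ ψ μ B := by
  obtain ⟨B, hB1, hB⟩ := h.exists_abs_wavelet_le
  refine ⟨B, hB1, fun μ _ _ => ⟨fun a => ?_, fun a ha x => ?_, fun a b ha hb => ?_⟩⟩
  · exact (h.measurable_wavelet a).comp (continuous_cdf μ).measurable
  · exact hB a ha _ ⟨cdf_nonneg μ x, cdf_le_one μ x⟩
  · rw [← h.orthonormal a b ha hb, ← map_cdf μ, integral_map]
    · rfl
    · exact (continuous_cdf μ).measurable.aemeasurable
    · exact ((h.measurable_wavelet a).mul (h.measurable_wavelet b)).aestronglyMeasurable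

end IsOrthonormalWavelet

lemma eLpNorm_sum_mul_of_orthonormal {ι α : Type*} [DecidableEq ι] [MeasurableSpace α]
    {μ : Measure α} {e : ι → α → ℝ} {S : Finset ι} (he : ∀ a ∈ S, MemLp (e a) 2 μ)
    (horth : ∀ a ∈ S, ∀ b ∈ S, ∫ x, e a x * e b x ∂μ = if a = b then 1 else 0) (c : ι → ℝ) :
    eLpNorm (fun x => ∑ a ∈ S, c a * e a x) 2 μ = ENNReal.ofReal √(∑ a ∈ S, c a ^ 2) := by
  have hmem : MemLp (fun x => ∑ a ∈ S, c a * e a x) 2 μ :=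
    memLp_finsetSum _ fun a ha => (he a ha).const_mul _
  have hint : ∀ a ∈ S, ∀ b ∈ S, Integrable (fun x => c a * c b * (e a x * e b x)) μ :=
    fun a ha b hb => ((he a ha).integrable_mul (he b hb)).const_mul _
  have hnorm : ∀ x, ‖∑ a ∈ S, c a * e a x‖ ^ (2 : ℝ≥0∞).toReal
      = ∑ a ∈ S, ∑ b ∈ S, c a * c b * (e a x * e b x) := by
    intro x
    simp_rw [mul_mul_mul_comm (c _), ← Finset.sum_mul_sum]
    simp [sq]
  have hsq : ∫ x, ‖∑ a ∈ S, c a * e a x‖ ^ (2 : ℝ≥0∞).toReal ∂μ = ∑ a ∈ S, c a ^ 2 := by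
    simp_rw [hnorm]
    rw [integral_finsetSum _ fun a ha => integrable_finsetSum _ (hint a ha)]
    refine Finset.sum_congr rfl fun a ha => ?_
    rw [integral_finsetSum _ (hint a ha)]
    calc ∑ b ∈ S, ∫ x, c a * c b * (e a x * e b x) ∂μ
        = ∑ b ∈ S, if a = b then c a * c b else 0 :=
          Finset.sum_congr rfl fun b hb => by
            rw [integral_const_mul, horth a ha b hb, mul_ite, mul_one, mul_zero]
      _ = c a ^ 2 := by rw [Finset.sum_ite_eq, if_pos ha, sq]
  rw [hmem.eLpNorm_eq_integral_rpow_norm two_ne_zero ENNReal.ofNat_ne_top, hsq, Real.sqrt_eq_rpow]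
  norm_num

namespace IsWarpedSystem

variable {φ ψ : ℝ → ℝ} {μ : Measure ℝ} {B : ℝ}

lemma memLp_warped [IsFiniteMeasure μ] (h : IsWarpedSystem φ ψ μ B) {a : Option (ℕ × ℕ)}
    (ha : IsIndex a) (p : ℝ≥0∞) : MemLp (warped φ ψ μ a) p μ :=
  MemLp.of_bound (h.measurable a).aestronglyMeasurable _ (.of_forall (h.abs_le a ha))

lemma eLpNorm_sum_mul_warped [IsFiniteMeasure μ] (h : IsWarpedSystem φ ψ μ B)
    {S : Finset (Option (ℕ × ℕ))} (hS : ∀ a ∈ S, IsIndex a) (c : Option (ℕ × ℕ) → ℝ) :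
    eLpNorm (fun x => ∑ a ∈ S, c a * warped φ ψ μ a x) 2 μ
      = ENNReal.ofReal √(∑ a ∈ S, c a ^ 2) :=
  eLpNorm_sum_mul_of_orthonormal (fun a ha => h.memLp_warped (hS a ha) 2)
    (fun a ha b hb => h.orthonormal a b (hS a ha) (hS b hb)) c

end IsWarpedSystem

/-! ### Bernstein's inequality -/

section Bernstein

variable {Ω : Type*} [MeasurableSpace Ω] {μ : Measure Ω} [IsProbabilityMeasure μ]

lemma mgf_le_exp_of_abs_le {g : Ω → ℝ} {b t : ℝ} (hg : AEMeasurable g μ)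
    (hb : ∀ᵐ ω ∂μ, |g ω| ≤ b) (ht : |t| * b ≤ 1) :
    mgf g μ t ≤ Real.exp (t * ∫ ω, g ω ∂μ + t ^ 2 * ∫ ω, g ω ^ 2 ∂μ) := by
  have hgi : Integrable g μ := Integrable.of_bound hg.aestronglyMeasurable b hb
  have hg2 : Integrable (fun ω => g ω ^ 2) μ :=
    (MemLp.of_bound hg.aestronglyMeasurable b hb).integrable_sq
  have hexp : ∀ᵐ ω ∂μ, Real.exp (t * g ω) ≤ 1 + t * g ω + t ^ 2 * g ω ^ 2 := by
    filter_upwards [hb] with ω hω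
    have htg : |t * g ω| ≤ 1 := by
      rw [abs_mul]
      exact (mul_le_mul_of_nonneg_left hω (abs_nonneg t)).trans ht
    linarith [(abs_le.1 (Real.abs_exp_sub_one_sub_id_le htg)).2, mul_pow t (g ω) 2]
  have hlin : Integrable (fun ω => 1 + t * g ω) μ := (integrable_const _).add (hgi.const_mul t)
  calc mgf g μ t ≤ ∫ ω, 1 + t * g ω + t ^ 2 * g ω ^ 2 ∂μ :=
        integral_mono_of_nonneg (.of_forall fun _ => (Real.exp_pos _).le)
          (hlin.add (hg2.const_mul _)) hexp
    _ = t * ∫ ω, g ω ∂μ + t ^ 2 * ∫ ω, g ω ^ 2 ∂μ + 1 := by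
        rw [integral_add hlin (hg2.const_mul _), integral_add (integrable_const _)
          (hgi.const_mul t), integral_const_mul, integral_const_mul, integral_const,
          probReal_univ, one_smul]
        ring
    _ ≤ _ := Real.add_one_le_exp _

variable {ι : Type*} {X : ι → Ω → ℝ} {s : Finset ι} {b ε V : ℝ}

lemma measureReal_sum_sub_integral_ge_le_exp (hind : iIndepFun X μ)
    (hX : ∀ i, Measurable (X i)) (hb : ∀ i, ∀ᵐ ω ∂μ, |X i ω| ≤ b)
    (hV : ∑ i ∈ s, ∫ ω, X i ω ^ 2 ∂μ ≤ V) (hb0 : 0 < b) (hV0 : 0 < V) (hε : 0 ≤ ε) :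
    μ.real {ω | ε ≤ ∑ i ∈ s, (X i ω - ∫ ω, X i ω ∂μ)}
      ≤ Real.exp (-min (ε ^ 2 / (4 * V)) (ε / (2 * b))) := by
  set t := min (ε / (2 * V)) (1 / b)
  set m := ∑ i ∈ s, ∫ ω, X i ω ∂μ
  have ht0 : 0 ≤ t := by positivity
  have htb : t * b ≤ 1 := (le_div_iff₀ hb0).1 (min_le_right _ _)
  have hsum : ∀ ω, (∑ i ∈ s, X i) ω = ∑ i ∈ s, X i ω := fun ω => Finset.sum_apply _ _ _
  have hint : Integrable (fun ω => Real.exp (t * (∑ i ∈ s, X i) ω)) μ :=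
    hind.integrable_exp_mul_sum hX fun i _ => integrable_exp_mul_of_mem_Icc (hX i).aemeasurable
      ((hb i).mono fun ω hω => abs_le.1 hω)
  have hmgf : mgf (∑ i ∈ s, X i) μ t ≤ Real.exp (t * m + t ^ 2 * V) := by
    rw [hind.mgf_sum hX]
    refine (Finset.prod_le_prod (fun i _ => mgf_nonneg) fun i _ =>
      mgf_le_exp_of_abs_le (hX i).aemeasurable (hb i) (by rwa [abs_of_nonneg ht0])).trans ?_
    rw [← Real.exp_sum, Finset.sum_add_distrib, ← Finset.mul_sum, ← Finset.mul_sum]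
    gcongr
  have hopt : min (ε ^ 2 / (4 * V)) (ε / (2 * b)) ≤ t * ε - t ^ 2 * V := by
    have htV : t * V ≤ ε / 2 := by
      have := (le_div_iff₀ (by positivity)).1 (min_le_left (ε / (2 * V)) (1 / b))
      linarith
    calc min (ε ^ 2 / (4 * V)) (ε / (2 * b)) = t * (ε / 2) := by
          rw [min_mul_of_nonneg _ _ (by positivity)]
          (congr 1 <;> field_simp); norm_num
      _ ≤ t * (ε - t * V) := by gcongr; linarith
      _ = t * ε - t ^ 2 * V := by ring
  calc μ.real {ω | ε ≤ ∑ i ∈ s, (X i ω - ∫ ω, X i ω ∂μ)}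
      = μ.real {ω | ε + m ≤ (∑ i ∈ s, X i) ω} := by
        simp_rw [hsum, Finset.sum_sub_distrib, le_sub_iff_add_le, m]
    _ ≤ Real.exp (-t * (ε + m)) * mgf (∑ i ∈ s, X i) μ t := measure_ge_le_exp_mul_mgf _ ht0 hint
    _ ≤ Real.exp (-t * (ε + m)) * Real.exp (t * m + t ^ 2 * V) := by gcongr
    _ ≤ Real.exp (-min (ε ^ 2 / (4 * V)) (ε / (2 * b))) := by
        rw [← Real.exp_add]
        gcongr
        linarith

lemma measureReal_abs_sum_sub_integral_ge_le_exp (hind : iIndepFun X μ)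
    (hX : ∀ i, Measurable (X i)) (hb : ∀ i, ∀ᵐ ω ∂μ, |X i ω| ≤ b)
    (hV : ∑ i ∈ s, ∫ ω, X i ω ^ 2 ∂μ ≤ V) (hb0 : 0 < b) (hV0 : 0 < V) (hε : 0 ≤ ε) :
    μ.real {ω | ε ≤ |∑ i ∈ s, (X i ω - ∫ ω, X i ω ∂μ)|}
      ≤ 2 * Real.exp (-min (ε ^ 2 / (4 * V)) (ε / (2 * b))) := by
  have hupper := measureReal_sum_sub_integral_ge_le_exp hind hX hb hV hb0 hV0 hε
  have hlower := measureReal_sum_sub_integral_ge_le_exp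
    (hind.comp (fun _ x => -x) fun _ => measurable_neg) (fun i => (hX i).neg)
    (fun i => by simpa using hb i) (by simpa using hV) hb0 hV0 hε
  rw [two_mul]
  refine (measureReal_mono fun ω hω => ?_).trans
    ((measureReal_union_le _ _).trans (add_le_add hupper hlower))
  rcases le_abs.1 (Set.mem_ofPred_eq ▸ hω) with h | h
  · exact Or.inl h
  · refine Or.inr ?_
    simpa only [Set.mem_ofPred_eq, Function.comp_apply, integral_neg, ← neg_sub',
      Finset.sum_neg_distrib] using h

lemma measure_pi_abs_mean_sub_integral_ge_le_exp {g : Ω → ℝ} {n : ℕ} {u v : ℝ}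
    (hg : Measurable g) (hb : ∀ᵐ ω ∂μ, |g ω| ≤ b) (hv : ∫ ω, g ω ^ 2 ∂μ ≤ v)
    (hb0 : 0 < b) (hv0 : 0 < v) (hu : 0 ≤ u) (hn : n ≠ 0) :
    (Measure.pi fun _ : Fin n => μ) {z | u ≤ |(n : ℝ)⁻¹ * ∑ i, g (z i) - ∫ ω, g ω ∂μ|}
      ≤ ENNReal.ofReal (2 * Real.exp (-(n * min (u ^ 2 / (4 * v)) (u / (2 * b))))) := by
  have hn0 : (0 : ℝ) < n := by exact_mod_cast hn.bot_lt
  have heval : ∀ i : Fin n, MeasurePreserving (Function.eval i) (Measure.pi fun _ => μ) μ :=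
    measurePreserving_eval fun _ => μ
  have hcomp : ∀ (i : Fin n) {h : Ω → ℝ}, Measurable h →
      ∫ z, h (z i) ∂(Measure.pi fun _ => μ) = ∫ ω, h ω ∂μ := by
    intro i h hh
    rw [← integral_map (heval i).measurable.aemeasurable hh.aestronglyMeasurable, (heval i).map_eq]
  have hbern := measureReal_abs_sum_sub_integral_ge_le_exp (s := Finset.univ) (ε := n * u)
    (V := n * v) (iIndepFun_pi fun _ : Fin n => hg.aemeasurable)
    (fun i => hg.comp (heval i).measurable)
    (fun i => (heval i).quasiMeasurePreserving.ae hb)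
    (by simpa [hcomp _ (hg.pow_const 2)] using mul_le_mul_of_nonneg_left hv hn0.le)
    hb0 (by positivity) (by positivity)
  have hexponent : min ((n * u) ^ 2 / (4 * (n * v))) (n * u / (2 * b))
      = n * min (u ^ 2 / (4 * v)) (u / (2 * b)) := by
    rw [mul_min_of_nonneg _ _ hn0.le]
    congr 1 <;> field_simp
  rw [← ofReal_measureReal, ← hexponent]
  refine ENNReal.ofReal_le_ofReal ((measureReal_mono fun z hz => ?_).trans hbern)
  have hdev : ∑ i, (g (z i) - ∫ ω, g ω ∂μ) = n * ((n : ℝ)⁻¹ * ∑ i, g (z i) - ∫ ω, g ω ∂μ) := by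
    rw [mul_sub, mul_inv_cancel_left₀ hn0.ne']
    simp
  simp only [Set.mem_ofPred_eq, hcomp _ hg, hdev, abs_mul, Nat.abs_cast] at hz ⊢
  gcongr

end Bernstein

/-! ### Dyadic trees -/

lemma mem_levelTree {J : ℕ} {p : ℕ × ℕ} : p ∈ levelTree J ↔ p.1 < J ∧ p.2 < 2 ^ p.1 := by
  simp only [levelTree, Finset.mem_filter, Finset.mem_product, Finset.mem_range]
  exact ⟨fun h => ⟨h.1.1, h.2⟩,
    fun h => ⟨⟨h.1, h.2.trans_le (Nat.pow_le_pow_right two_pos h.1.le)⟩, h.2⟩⟩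

lemma card_levelTree_add_one (J : ℕ) : (levelTree J).card + 1 = 2 ^ J := by
  have hsigma : levelTree J = ((Finset.range J).sigma fun j => Finset.range (2 ^ j)).map
      (Equiv.sigmaEquivProd ℕ ℕ).toEmbedding := by
    ext p
    simp [mem_levelTree]
  rw [hsigma, Finset.card_map, Finset.card_sigma]
  simp only [Finset.card_range, Nat.geomSum_eq le_rfl]
  simp [Nat.sub_add_cancel Nat.one_le_two_pow]

lemma mem_children {p q : ℕ × ℕ} : q ∈ children p ↔ q.1 = p.1 + 1 ∧ q.2 / 2 = p.2 := by
  simp only [children, Finset.mem_insert, Finset.mem_singleton, Prod.ext_iff]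
  omega

lemma isBelow_refl (p : ℕ × ℕ) : IsBelow p p := by simp [IsBelow]

lemma children_subset_levelTree {J : ℕ} {p : ℕ × ℕ} (hp : p ∈ levelTree J) :
    children p ⊆ levelTree (J + 1) := by
  intro q hq
  rw [mem_levelTree] at hp ⊢
  obtain ⟨hlevel, hpos⟩ := mem_children.1 hq
  rw [hlevel, pow_succ]
  omega

lemma exists_parent {J : ℕ} {q : ℕ × ℕ} (hq : q ∈ levelTree (J + 1)) (h0 : q ≠ (0, 0)) :
    ∃ p ∈ levelTree J, q ∈ children p := by
  obtain ⟨_ | j, k⟩ := q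
  · simp_all [mem_levelTree]
  · obtain ⟨hj, hk⟩ := mem_levelTree.1 hq
    refine ⟨(j, k / 2), mem_levelTree.2 ⟨Nat.lt_of_succ_lt_succ hj, ?_⟩, mem_children.2 ⟨rfl, rfl⟩⟩
    dsimp only at hk ⊢
    rw [pow_succ] at hk
    omega

/-- The indices of the wavelets that occur in `treeSum φ ψ μ d T`. -/
def treeIndices (T : Finset (ℕ × ℕ)) : Finset (Option (ℕ × ℕ)) :=
  (T ∪ outerLeaves T).insertNone

lemma treeSum_eq_sum (φ ψ : ℝ → ℝ) (μ : Measure ℝ) (d : Option (ℕ × ℕ) → ℝ)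
    (T : Finset (ℕ × ℕ)) (x : ℝ) :
    treeSum φ ψ μ d T x = ∑ a ∈ treeIndices T, d a * warped φ ψ μ a x :=
  (Finset.sum_insertNone (fun a => d a * warped φ ψ μ a x) _).symm

lemma union_outerLeaves (T : Finset (ℕ × ℕ)) :
    T ∪ outerLeaves T = T ∪ insert (0, 0) (T.biUnion children) :=
  Finset.union_sdiff_self_eq_union

lemma union_outerLeaves_mono {S T : Finset (ℕ × ℕ)} (h : S ⊆ T) :
    S ∪ outerLeaves S ⊆ T ∪ outerLeaves T := by
  simp only [union_outerLeaves]
  exact Finset.union_subset_union h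
    (Finset.insert_subset_insert _ (Finset.biUnion_subset_biUnion_of_subset_left _ h))

lemma treeIndices_mono {S T : Finset (ℕ × ℕ)} (h : S ⊆ T) : treeIndices S ⊆ treeIndices T :=
  Finset.insertNone.monotone (union_outerLeaves_mono h)

lemma treeIndices_levelTree (J : ℕ) :
    treeIndices (levelTree J) = (levelTree (J + 1)).insertNone := by
  rw [treeIndices, union_outerLeaves]
  congr 1
  ext q
  simp only [Finset.mem_union, Finset.mem_insert, Finset.mem_biUnion]
  refine ⟨?_, fun hq => or_iff_not_imp_left.2 fun _ => or_iff_not_imp_left.2 (exists_parent hq)⟩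
  rintro (hq | rfl | ⟨p, hp, hq⟩)
  · exact mem_levelTree.2 ((mem_levelTree.1 hq).imp_left Nat.lt_succ_of_lt)
  · simp [mem_levelTree]
  · exact children_subset_levelTree hp hq

lemma isIndex_of_mem_treeIndices {J : ℕ} {a : Option (ℕ × ℕ)}
    (ha : a ∈ treeIndices (levelTree J)) : IsIndex a := by
  rw [treeIndices_levelTree] at ha
  cases a with
  | none => trivial
  | some p => exact (mem_levelTree.1 (Finset.some_mem_insertNone.1 ha)).2

lemma level_le_of_mem_treeIndices {J : ℕ} {a : Option (ℕ × ℕ)}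
    (ha : a ∈ treeIndices (levelTree J)) : level a ≤ J := by
  rw [treeIndices_levelTree] at ha
  cases a with
  | none => exact Nat.zero_le J
  | some p => exact Nat.le_of_lt_succ (mem_levelTree.1 (Finset.some_mem_insertNone.1 ha)).1

lemma card_treeIndices_levelTree (J : ℕ) : (treeIndices (levelTree J)).card = 2 ^ (J + 1) := by
  rw [treeIndices_levelTree, Finset.card_insertNone, card_levelTree_add_one]

lemma card_treeIndices_le (T : Finset (ℕ × ℕ)) : (treeIndices T).card ≤ 3 * T.card + 2 := by
  rw [treeIndices, Finset.card_insertNone, union_outerLeaves]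
  have hbiUnion : (T.biUnion children).card ≤ T.card * 2 :=
    Finset.card_biUnion_le_card_mul _ _ _ fun p _ => Finset.card_le_two
  have hunion := Finset.card_union_le T (insert (0, 0) (T.biUnion children))
  have hinsert := Finset.card_insert_le (0, 0) (T.biUnion children)
  omega

/-! ### Thresholding sparse sequences -/

lemma setIntegral_Ioc_indicator_Iic {ν Λ : ℝ} (h0 : 0 ≤ ν) (hν : ν ≤ Λ) :
    ∫ t in Set.Ioc 0 Λ, (Set.Iic ν).indicator (fun t => 2 * t) t = ν ^ 2 := by
  rw [setIntegral_indicator measurableSet_Iic, Set.Ioc_inter_Iic, min_eq_right hν,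
    ← intervalIntegral.integral_of_le h0, intervalIntegral.integral_const_mul, integral_id]
  ring

-- Layer-cake: `∑ ν² = ∫ 2 t #{ν ≥ t} dt`.
lemma sum_sq_le_of_card_le {ι : Type*} {S : Finset ι} {ν : ι → ℝ} {C q Λ : ℝ} (hΛ : 0 ≤ Λ)
    (hν : ∀ i ∈ S, ν i ∈ Set.Icc 0 Λ) (hq : q < 2)
    (hcard : ∀ t, 0 < t → ((S.filter fun i => t ≤ ν i).card : ℝ) ≤ C * t ^ (-q)) :
    ∑ i ∈ S, ν i ^ 2 ≤ 2 * C / (2 - q) * Λ ^ (2 - q) := by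
  have hint : ∀ i ∈ S, IntegrableOn ((Set.Iic (ν i)).indicator fun t => 2 * t) (Set.Ioc 0 Λ) :=
    fun i _ => (Continuous.integrableOn_Ioc (by fun_prop)).indicator measurableSet_Iic
  have hlayer : ∀ t ∈ Set.Ioc 0 Λ, ∑ i ∈ S, (Set.Iic (ν i)).indicator (fun t => 2 * t) t
      ≤ 2 * C * t ^ (1 - q) := by
    intro t ht
    calc ∑ i ∈ S, (Set.Iic (ν i)).indicator (fun t => 2 * t) t
        = (S.filter fun i => t ≤ ν i).card * (2 * t) := by
          simp_rw [Set.indicator_apply, Set.mem_Iic, ← Finset.sum_filter, Finset.sum_const,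
            nsmul_eq_mul]
      _ ≤ C * t ^ (-q) * (2 * t) :=
          mul_le_mul_of_nonneg_right (hcard t ht.1) (by linarith [ht.1])
      _ = 2 * C * t ^ (1 - q) := by
          rw [sub_eq_neg_add, Real.rpow_add ht.1, Real.rpow_one]
          ring
  have hpow : IntegrableOn (fun t => 2 * C * t ^ (1 - q)) (Set.Ioc 0 Λ) :=
    ((intervalIntegral.intervalIntegrable_rpow' (by linarith)).const_mul _).1
  calc ∑ i ∈ S, ν i ^ 2
      = ∑ i ∈ S, ∫ t in Set.Ioc 0 Λ, (Set.Iic (ν i)).indicator (fun t => 2 * t) t :=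
        Finset.sum_congr rfl fun i hi =>
          (setIntegral_Ioc_indicator_Iic (hν i hi).1 (hν i hi).2).symm
    _ = ∫ t in Set.Ioc 0 Λ, ∑ i ∈ S, (Set.Iic (ν i)).indicator (fun t => 2 * t) t :=
        (integral_finsetSum _ hint).symm
    _ ≤ ∫ t in Set.Ioc 0 Λ, 2 * C * t ^ (1 - q) :=
        setIntegral_mono_on (integrable_finsetSum _ hint) hpow measurableSet_Ioc hlayer
    _ = 2 * C / (2 - q) * Λ ^ (2 - q) := by
        rw [← intervalIntegral.integral_of_le hΛ, intervalIntegral.integral_const_mul,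
          integral_rpow (Or.inl (by linarith)), Real.zero_rpow (by linarith)]
        ring_nf

lemma residual_nonneg (d : Option (ℕ × ℕ) → ℝ) (p : ℕ × ℕ) : 0 ≤ residual d p :=
  Real.sqrt_nonneg _

lemma residual_sq (d : Option (ℕ × ℕ) → ℝ) (p : ℕ × ℕ) :
    residual d p ^ 2 = ∑ q ∈ children p, d (some q) ^ 2 :=
  Real.sq_sqrt (Finset.sum_nonneg fun _ _ => sq_nonneg _)

lemma residual_eq_norm (d : Option (ℕ × ℕ) → ℝ) (p : ℕ × ℕ) :
    residual d p = ‖WithLp.toLp 2 fun q : children p => d (some q)‖ := by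
  rw [EuclideanSpace.norm_eq, residual, ← Finset.sum_coe_sort]
  simp

lemma abs_residual_sub_le {d d' : Option (ℕ × ℕ) → ℝ} {p : ℕ × ℕ} {δ : ℝ}
    (h : ∀ q ∈ children p, |d' (some q) - d (some q)| ≤ δ) :
    |residual d' p - residual d p| ≤ 2 * δ := by
  have hδ : 0 ≤ δ := (abs_nonneg _).trans (h _ (Finset.mem_insert_self _ _))
  have hdiff : residual (d' - d) p ≤ 2 * δ := by
    refine Real.sqrt_le_iff.2 ⟨by positivity, ?_⟩
    calc ∑ q ∈ children p, (d' - d) (some q) ^ 2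
        ≤ (children p).card • δ ^ 2 :=
          Finset.sum_le_card_nsmul _ _ _ fun q hq => sq_le_sq.2 ((h q hq).trans (le_abs_self δ))
      _ ≤ 4 • δ ^ 2 := nsmul_le_nsmul_left (sq_nonneg δ) (Finset.card_le_two.trans (by norm_num))
      _ = (2 * δ) ^ 2 := by rw [nsmul_eq_mul]; ring
  simp only [residual_eq_norm] at hdiff ⊢
  exact (abs_norm_sub_norm_le _ _).trans hdiff

/-- The nodes that contain a node of residual at least `lam`: the tree `𝒯(f, lam)` in terms of
the coefficients of `f`. -/
def significantTree (d : Option (ℕ × ℕ) → ℝ) (lam : ℝ) : Set (ℕ × ℕ) :=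
  {p | ∃ q : ℕ × ℕ, q.2 < 2 ^ q.1 ∧ IsBelow q p ∧ lam ≤ residual d q}

open Classical in
/-- The part of `significantTree` that nodes of level `< J` generate: the tree which the
estimator selects from the coefficients `d`. -/
noncomputable def thresholdTree (d : Option (ℕ × ℕ) → ℝ) (lam : ℝ) (J : ℕ) : Finset (ℕ × ℕ) :=
  (levelTree J).filter fun p => ∃ q ∈ levelTree J, IsBelow q p ∧ lam ≤ residual d q

/-- The good event of the analysis: the coefficients `d'` approximate `d` up to `δ` at all
indices which the expansion on `levelTree J` involves. -/
def CoeffsWithin (d d' : Option (ℕ × ℕ) → ℝ) (δ : ℝ) (J : ℕ) : Prop :=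
  ∀ a ∈ treeIndices (levelTree J), |d' a - d a| ≤ δ

/-- The sequence form of membership in `ℬ^s`, where `q = (s + 1/2)⁻¹`. -/
def IsSparse (d : Option (ℕ × ℕ) → ℝ) (q C : ℝ) : Prop :=
  ∀ lam : ℝ, 0 < lam → (significantTree d lam).Finite ∧
    lam ^ q * ((significantTree d lam).ncard : ℝ) ≤ C

lemma mem_thresholdTree {d : Option (ℕ × ℕ) → ℝ} {lam : ℝ} {J : ℕ} {p : ℕ × ℕ} :
    p ∈ thresholdTree d lam J ↔
      p ∈ levelTree J ∧ ∃ q ∈ levelTree J, IsBelow q p ∧ lam ≤ residual d q := by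
  classical exact Finset.mem_filter

lemma thresholdTree_subset (d : Option (ℕ × ℕ) → ℝ) (lam : ℝ) (J : ℕ) :
    thresholdTree d lam J ⊆ levelTree J :=
  fun _ hp => (mem_thresholdTree.1 hp).1

section Sparse

variable {d d' : Option (ℕ × ℕ) → ℝ} {q C δ lam : ℝ} {J : ℕ} {T : Finset (ℕ × ℕ)}

lemma IsSparse.card_le (hd : IsSparse d q C) (hlam : 0 < lam)
    (hT : ↑T ⊆ significantTree d lam) : (T.card : ℝ) ≤ C * lam ^ (-q) := by
  obtain ⟨hfin, hcard⟩ := hd lam hlam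
  have hTcard : (T.card : ℝ) ≤ (significantTree d lam).ncard := by
    rw [← Set.ncard_coe_finset]
    exact_mod_cast Set.ncard_le_ncard hT hfin
  rw [Real.rpow_neg hlam.le, ← div_eq_mul_inv, le_div_iff₀' (by positivity)]
  exact (mul_le_mul_of_nonneg_left hTcard (by positivity)).trans hcard

lemma CoeffsWithin.abs_residual_sub_le (h : CoeffsWithin d d' δ J) {p : ℕ × ℕ}
    (hp : p ∈ levelTree J) : |residual d' p - residual d p| ≤ 2 * δ := by
  refine WarpedWavelet.abs_residual_sub_le fun q hq => h _ ?_
  rw [treeIndices_levelTree]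
  exact Finset.some_mem_insertNone.2 (children_subset_levelTree hp hq)

lemma CoeffsWithin.thresholdTree_subset_significantTree (h : CoeffsWithin d d' δ J) :
    ↑(thresholdTree d' lam J) ⊆ significantTree d (lam - 2 * δ) := by
  intro p hp
  obtain ⟨-, q, hq, hqp, hlam⟩ := mem_thresholdTree.1 (Finset.mem_coe.1 hp)
  exact ⟨q, (mem_levelTree.1 hq).2, hqp, by linarith [abs_le.1 (h.abs_residual_sub_le hq)]⟩

lemma CoeffsWithin.residual_le_of_notMem (h : CoeffsWithin d d' δ J) {p : ℕ × ℕ}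
    (hp : p ∈ levelTree J \ thresholdTree d' lam J) : residual d p ≤ lam + 2 * δ := by
  obtain ⟨hpJ, hpT⟩ := Finset.mem_sdiff.1 hp
  have hsmall : residual d' p < lam := by
    by_contra! hle
    exact hpT (mem_thresholdTree.2 ⟨hpJ, p, hpJ, isBelow_refl p, hle⟩)
  linarith [abs_le.1 (h.abs_residual_sub_le hpJ)]

lemma IsSparse.sum_residual_sq_le (hd : IsSparse d q C) (hq : q < 2) {Λ : ℝ} (hΛ : 0 ≤ Λ)
    (hT : T ⊆ levelTree J) (hres : ∀ p ∈ T, residual d p ≤ Λ) :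
    ∑ p ∈ T, residual d p ^ 2 ≤ 2 * C / (2 - q) * Λ ^ (2 - q) := by
  refine sum_sq_le_of_card_le hΛ (fun p hp => ⟨residual_nonneg d p, hres p hp⟩) hq fun t ht =>
    hd.card_le ht fun p hp => ?_
  obtain ⟨hpT, hpt⟩ := Finset.mem_filter.1 (Finset.mem_coe.1 hp)
  exact ⟨p, (mem_levelTree.1 (hT hpT)).2, isBelow_refl p, hpt⟩

lemma CoeffsWithin.sum_sq_sub_le (h : CoeffsWithin d d' δ J) (hT : T ⊆ levelTree J) :
    ∑ a ∈ treeIndices T, (d' a - d a) ^ 2 ≤ (3 * T.card + 2) * δ ^ 2 := by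
  have hcard : ((treeIndices T).card : ℝ) ≤ 3 * T.card + 2 := by
    exact_mod_cast card_treeIndices_le T
  calc ∑ a ∈ treeIndices T, (d' a - d a) ^ 2
      ≤ (treeIndices T).card • δ ^ 2 := Finset.sum_le_card_nsmul _ _ _ fun a ha =>
        sq_le_sq.2 ((h a (treeIndices_mono hT ha)).trans (le_abs_self δ))
    _ ≤ (3 * T.card + 2) * δ ^ 2 := by
        rw [nsmul_eq_mul]
        gcongr

lemma IsSparse.sum_residual_sq_add_sum_sq_sub_le (hd : IsSparse d q C) (hq : q < 2)
    (hlam : 0 < lam) (h : CoeffsWithin d d' (lam / 4) J) :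
    ∑ p ∈ levelTree J \ thresholdTree d' lam J, residual d p ^ 2
        + ∑ a ∈ treeIndices (thresholdTree d' lam J), (d' a - d a) ^ 2
      ≤ C * (2 ^ (3 - q) / (2 - q) + 2 ^ q) * lam ^ (2 - q) + lam ^ 2 := by
  set T := thresholdTree d' lam J
  have hdiscarded : ∑ p ∈ levelTree J \ T, residual d p ^ 2
      ≤ 2 * C / (2 - q) * (2 * lam) ^ (2 - q) :=
    hd.sum_residual_sq_le hq (by positivity) Finset.sdiff_subset fun p hp =>
      (h.residual_le_of_notMem hp).trans (by linarith)
  have hcard : (T.card : ℝ) ≤ C * (lam / 2) ^ (-q) := hd.card_le (by positivity) <| by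
    convert h.thresholdTree_subset_significantTree using 2
    ring
  have hpow : lam ^ (-q) * lam ^ 2 = lam ^ (2 - q) := by
    rw [sub_eq_neg_add, Real.rpow_add hlam, Real.rpow_two]
  calc _ ≤ 2 * C / (2 - q) * (2 * lam) ^ (2 - q) + (3 * T.card + 2) * (lam / 4) ^ 2 :=
        add_le_add hdiscarded (h.sum_sq_sub_le (thresholdTree_subset d' lam J))
    _ ≤ 2 * C / (2 - q) * (2 * lam) ^ (2 - q)
          + (16 * (C * (lam / 2) ^ (-q)) + 16) * (lam / 4) ^ 2 := by
        gcongr <;> linarith [hcard, (T.card.cast_nonneg : (0 : ℝ) ≤ _)]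
    _ = C * (2 ^ (3 - q) / (2 - q) + 2 ^ q) * lam ^ (2 - q) + lam ^ 2 := by
        rw [Real.mul_rpow two_pos.le hlam.le, Real.div_rpow hlam.le two_pos.le,
          Real.rpow_neg two_pos.le q, ← hpow,
          show (3 : ℝ) - q = 1 + (2 - q) by ring, Real.rpow_add two_pos, Real.rpow_one]
        field_simp
        ring

end Sparse

/-! ### The error of a tree-structured expansion -/

lemma sum_sq_sdiff_treeIndices_le (d : Option (ℕ × ℕ) → ℝ) (J : ℕ) (T : Finset (ℕ × ℕ)) :
    ∑ a ∈ treeIndices (levelTree J) \ treeIndices T, d a ^ 2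
      ≤ ∑ p ∈ levelTree J \ T, residual d p ^ 2 := by
  have hcover : treeIndices (levelTree J) \ treeIndices T
      ⊆ (levelTree J \ T).biUnion fun p => (children p).map .some := by
    intro a ha
    rw [treeIndices_levelTree, treeIndices, union_outerLeaves] at ha
    rcases a with _ | q
    · simp at ha
    · simp only [Finset.mem_sdiff, Finset.some_mem_insertNone, Finset.mem_union,
        Finset.mem_insert, Finset.mem_biUnion, not_or, not_exists, not_and] at ha
      obtain ⟨p, hp, hqp⟩ := exists_parent ha.1 ha.2.2.1
      refine Finset.mem_biUnion.2 ⟨p, Finset.mem_sdiff.2 ⟨hp, fun hpT => ?_⟩,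
        Finset.mem_map_of_mem _ hqp⟩
      exact ha.2.2.2 p hpT hqp
  have hdisj : Set.PairwiseDisjoint ↑(levelTree J \ T)
      fun p => (children p).map (.some : ℕ × ℕ ↪ Option (ℕ × ℕ)) := by
    intro p _ p' _ hne
    refine (Finset.disjoint_map _).2 (Finset.disjoint_left.2 fun q hq hq' => hne ?_)
    rw [mem_children] at hq hq'
    exact Prod.ext (by omega) (by omega)
  refine (Finset.sum_le_sum_of_subset_of_nonneg hcover fun _ _ _ => sq_nonneg _).trans_eq ?_
  rw [Finset.sum_biUnion hdisj]
  simp only [Finset.sum_map, residual_sq, Function.Embedding.some_apply]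

namespace IsWarpedSystem

variable {φ ψ : ℝ → ℝ} {μ : Measure ℝ} {B : ℝ}

lemma measurable_treeSum (h : IsWarpedSystem φ ψ μ B) (d : Option (ℕ × ℕ) → ℝ)
    (T : Finset (ℕ × ℕ)) : Measurable (treeSum φ ψ μ d T) := by
  simp_rw [funext (treeSum_eq_sum φ ψ μ d T)]
  exact Finset.measurable_fun_sum _ fun a _ => (h.measurable a).const_mul _

lemma eLpNorm_treeSum_sub_treeSum_le [IsFiniteMeasure μ] (h : IsWarpedSystem φ ψ μ B) {J : ℕ}
    {T : Finset (ℕ × ℕ)} (hT : T ⊆ levelTree J) (d d' : Option (ℕ × ℕ) → ℝ) :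
    eLpNorm (fun x => treeSum φ ψ μ d (levelTree J) x - treeSum φ ψ μ d' T x) 2 μ
      ≤ ENNReal.ofReal √(∑ p ∈ levelTree J \ T, residual d p ^ 2
          + ∑ a ∈ treeIndices T, (d' a - d a) ^ 2) := by
  set V := treeIndices (levelTree J)
  set U := treeIndices T
  have hUV : U ⊆ V := treeIndices_mono hT
  set c : Option (ℕ × ℕ) → ℝ := fun a => d a - if a ∈ U then d' a else 0
  have hexpand : (fun x => treeSum φ ψ μ d (levelTree J) x - treeSum φ ψ μ d' T x)
      = fun x => ∑ a ∈ V, c a * warped φ ψ μ a x := by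
    funext x
    simp only [treeSum_eq_sum, c, sub_mul, Finset.sum_sub_distrib, ite_mul, zero_mul,
      ← Finset.sum_filter, Finset.filter_mem_eq_inter, Finset.inter_eq_right.2 hUV, V, U]
  rw [hexpand, h.eLpNorm_sum_mul_warped fun a ha => isIndex_of_mem_treeIndices ha]
  refine ENNReal.ofReal_le_ofReal (Real.sqrt_le_sqrt ?_)
  rw [← Finset.sum_sdiff hUV]
  refine add_le_add (le_trans (le_of_eq ?_) (sum_sq_sdiff_treeIndices_le d J T)) (le_of_eq ?_)
  · refine Finset.sum_congr rfl fun a ha => ?_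
    have haU : a ∉ U := (Finset.mem_sdiff.1 ha).2
    simp [c, haU]
  · exact Finset.sum_congr rfl fun a ha => by simp [c, ha, sub_sq_comm]

lemma eLpNorm_sub_treeSum_le [IsFiniteMeasure μ] (h : IsWarpedSystem φ ψ μ B) {f : ℝ → ℝ}
    (hf : AEStronglyMeasurable f μ) {J : ℕ} {T : Finset (ℕ × ℕ)} (hT : T ⊆ levelTree J)
    (d d' : Option (ℕ × ℕ) → ℝ) :
    eLpNorm (fun x => f x - treeSum φ ψ μ d' T x) 2 μ
      ≤ eLpNorm (fun x => f x - treeSum φ ψ μ d (levelTree J) x) 2 μ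
        + ENNReal.ofReal √(∑ p ∈ levelTree J \ T, residual d p ^ 2
            + ∑ a ∈ treeIndices T, (d' a - d a) ^ 2) := by
  have hmeas : ∀ c S, AEStronglyMeasurable (treeSum φ ψ μ c S) μ :=
    fun c S => (h.measurable_treeSum c S).aestronglyMeasurable
  have hsplit : (fun x => f x - treeSum φ ψ μ d' T x)
      = (fun x => f x - treeSum φ ψ μ d (levelTree J) x)
        + fun x => treeSum φ ψ μ d (levelTree J) x - treeSum φ ψ μ d' T x := by
    funext x
    simp
  rw [hsplit]
  exact (eLpNorm_add_le (hf.sub (hmeas _ _)) ((hmeas _ _).sub (hmeas _ _)) one_le_two).trans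
    (add_le_add le_rfl (h.eLpNorm_treeSum_sub_treeSum_le hT d d'))

end IsWarpedSystem

/-! ### Threshold and truncation level -/

lemma bddAbove_two_pow_le (x : ℝ) : BddAbove {j : ℕ | (2 : ℝ) ^ j ≤ x} := by
  obtain ⟨N, hN⟩ := exists_nat_gt x
  refine ⟨N, fun j hj => ?_⟩
  have hj' : (j : ℝ) < 2 ^ j := by exact_mod_cast Nat.lt_two_pow_self
  exact_mod_cast ((hj'.trans_le hj).trans hN).le

lemma lt_two_pow_truncLevel_succ (γ lam : ℝ) :
    lam ^ (-1 / γ) < (2 : ℝ) ^ (truncLevel γ lam + 1) := by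
  by_contra hle
  exact Nat.not_succ_le_self _ (le_csSup (bddAbove_two_pow_le _) (not_lt.1 hle))

lemma two_rpow_neg_truncLevel_le {γ lam : ℝ} (hγ : 0 < γ) (hlam : 0 < lam) :
    (2 : ℝ) ^ (-(truncLevel γ lam * γ)) ≤ 2 ^ γ * lam := by
  have h := Real.rpow_le_rpow (by positivity) (lt_two_pow_truncLevel_succ γ lam).le hγ.le
  rw [← Real.rpow_mul hlam.le, div_mul_cancel₀ _ hγ.ne', Real.rpow_neg_one, ← Real.rpow_natCast,
    ← Real.rpow_mul (by norm_num), Nat.cast_add, Nat.cast_one, add_mul, one_mul,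
    Real.rpow_add (by norm_num), inv_le_iff_one_le_mul₀ hlam] at h
  rw [Real.rpow_neg (by norm_num), inv_le_iff_one_le_mul₀ (by positivity)]
  linarith

lemma two_pow_truncLevel_mul_le {γ lam : ℝ} (hγ : 1 / 2 ≤ γ) (hlam : 0 < lam) :
    (2 : ℝ) ^ truncLevel γ lam * min lam 1 ^ 2 ≤ 1 := by
  have hγ0 : 0 < γ := by linarith
  have hm : 0 < min lam 1 := lt_min hlam one_pos
  rcases Set.eq_empty_or_nonempty {j : ℕ | (2 : ℝ) ^ j ≤ lam ^ (-1 / γ)} with he | hne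
  · have hzero : truncLevel γ lam = 0 := by rw [truncLevel, he, csSup_empty, bot_eq_zero]
    rw [hzero, pow_zero, one_mul]
    exact pow_le_one₀ hm.le (min_le_right _ _)
  · rw [← le_inv_mul_iff₀' (by positivity), mul_one]
    calc (2 : ℝ) ^ truncLevel γ lam ≤ lam ^ (-1 / γ) := Nat.sSup_mem hne (bddAbove_two_pow_le _)
      _ ≤ min lam 1 ^ (-1 / γ) := Real.rpow_le_rpow_of_nonpos hm (min_le_left _ _)
          (div_nonpos_of_nonpos_of_nonneg (by norm_num) hγ0.le)
      _ ≤ min lam 1 ^ (-2 : ℝ) := by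
          refine Real.rpow_le_rpow_of_exponent_ge hm (min_le_right _ _) ?_
          rw [le_div_iff₀ hγ0]
          linarith
      _ = (min lam 1 ^ 2)⁻¹ := by rw [Real.rpow_neg hm.le, Real.rpow_two]

lemma two_rpow_half_sq (J : ℕ) : ((2 : ℝ) ^ ((J : ℝ) / 2)) ^ 2 = 2 ^ J := by
  rw [← Real.rpow_mul_natCast two_pos.le, Nat.cast_ofNat, div_mul_cancel₀ _ two_ne_zero,
    Real.rpow_natCast]

lemma two_rpow_half_truncLevel_mul_le {γ lam : ℝ} (hγ : 1 / 2 ≤ γ) (hlam : 0 < lam) :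
    (2 : ℝ) ^ ((truncLevel γ lam : ℝ) / 2) * min lam 1 ≤ 1 := by
  have : 0 < min lam 1 := lt_min hlam one_pos
  refine (sq_le_one_iff₀ (by positivity)).1 ?_
  rw [mul_pow, two_rpow_half_sq]
  exact two_pow_truncLevel_mul_le hγ hlam

section Threshold

variable {κ : ℝ} {n : ℕ}

lemma log_div_pos (hn : 2 ≤ n) : 0 < Real.log n / n := by
  have hn2 : (2 : ℝ) ≤ n := by exact_mod_cast hn
  exact div_pos (Real.log_pos (by linarith)) (by linarith)

lemma log_div_le_one (hn : 2 ≤ n) : Real.log n / n ≤ 1 := by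
  have hn2 : (2 : ℝ) ≤ n := by exact_mod_cast hn
  rw [div_le_one (by linarith)]
  linarith [Real.log_le_sub_one_of_pos (by linarith : (0 : ℝ) < n)]

lemma half_le_log (hn : 2 ≤ n) : 1 / 2 ≤ Real.log n := by
  have hlog := Real.log_le_log two_pos (by exact_mod_cast hn : (2 : ℝ) ≤ n)
  linarith [Real.log_two_gt_d9]

lemma threshold_pos (hκ : 0 < κ) (hn : 2 ≤ n) : 0 < threshold κ n :=
  mul_pos hκ (Real.sqrt_pos.2 (log_div_pos hn))

lemma mul_threshold_sq (hn : 2 ≤ n) : n * threshold κ n ^ 2 = κ ^ 2 * Real.log n := by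
  have hn0 : (n : ℝ) ≠ 0 := by positivity
  rw [threshold, mul_pow, Real.sq_sqrt (log_div_pos hn).le]
  field_simp

lemma mul_log_le_mul_threshold (hκ : 1 ≤ κ) (hn : 2 ≤ n) :
    κ * Real.log n ≤ n * (min (threshold κ n) 1 * threshold κ n) := by
  have hlog := half_le_log hn
  rcases le_total (threshold κ n) 1 with h | h
  · rw [min_eq_left h, ← sq, mul_threshold_sq hn]
    gcongr
    exact le_self_pow₀ hκ two_ne_zero
  · have hle : Real.log n / n ≤ √(Real.log n / n) :=
      Real.le_sqrt_of_sq_le (pow_le_of_le_one (log_div_pos hn).le (log_div_le_one hn) two_ne_zero)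
    rw [div_le_iff₀' (by positivity)] at hle
    rw [min_eq_right h, one_mul, threshold, mul_left_comm]
    gcongr

lemma two_pow_truncLevel_threshold_le {γ : ℝ} (hγ : 1 / 2 ≤ γ) (hκ : 2 ≤ κ) (hn : 2 ≤ n) :
    (2 : ℝ) ^ truncLevel γ (threshold κ n) ≤ n := by
  have hlam : 0 < threshold κ n := threshold_pos (by linarith) hn
  have hmin : 1 ≤ n * min (threshold κ n) 1 ^ 2 := by
    rcases le_total (threshold κ n) 1 with h | h
    · rw [min_eq_left h, mul_threshold_sq hn]
      nlinarith [half_le_log hn]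
    · rw [min_eq_right h, one_pow, mul_one]
      exact_mod_cast (by omega : 1 ≤ n)
  have : 0 < min (threshold κ n) 1 := lt_min hlam one_pos
  exact le_of_mul_le_mul_right ((two_pow_truncLevel_mul_le hγ hlam).trans hmin) (by positivity)

variable {s : ℝ}

lemma threshold_rpow (hs : 0 < s) (hκ : 0 ≤ κ) (hn : 2 ≤ n) :
    threshold κ n ^ (2 - (s + 1 / 2)⁻¹)
      = κ ^ (2 - (s + 1 / 2)⁻¹) * ((Real.log n / n) ^ (s / (2 * s + 1))) ^ 2 := by
  have hx := (log_div_pos hn).le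
  rw [threshold, Real.mul_rpow hκ (Real.sqrt_nonneg _), Real.sqrt_eq_rpow, ← Real.rpow_mul hx,
    ← Real.rpow_mul_natCast hx]
  congr 2
  push_cast
  field_simp
  ring

lemma threshold_le (hs : 0 < s) (hκ : 0 ≤ κ) (hn : 2 ≤ n) :
    threshold κ n ≤ κ * (Real.log n / n) ^ (s / (2 * s + 1)) := by
  rw [threshold, Real.sqrt_eq_rpow]
  refine mul_le_mul_of_nonneg_left ?_ hκ
  refine Real.rpow_le_rpow_of_exponent_ge (log_div_pos hn) (log_div_le_one hn) ?_
  rw [div_le_div_iff₀ (by positivity) two_pos]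
  linarith

lemma rpow_neg_one_le (hs : 0 < s) (hn : 2 ≤ n) :
    (n : ℝ) ^ (-1 : ℝ) ≤ 2 * (Real.log n / n) ^ (2 * s / (2 * s + 1)) := by
  calc (n : ℝ) ^ (-1 : ℝ) ≤ 2 * (Real.log n / n) := by
        rw [Real.rpow_neg_one, ← mul_div_assoc, ← one_div]
        gcongr
        linarith [half_le_log hn]
    _ ≤ 2 * (Real.log n / n) ^ (2 * s / (2 * s + 1)) := by
        gcongr
        refine Real.self_le_rpow_of_le_one (log_div_pos hn).le (log_div_le_one hn) ?_
        rw [div_le_one (by positivity)]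
        linarith

end Threshold

/-! ### Concentration of the empirical coefficients -/

section Regression

variable {P : Measure (ℝ × ℝ)} {g : ℝ → ℝ} {K : ℝ}

lemma IsRegressionFunction.integral_snd_mul [IsFiniteMeasure P] {f : ℝ → ℝ}
    (hf : IsRegressionFunction P f) (hY : Integrable (Prod.snd : ℝ × ℝ → ℝ) P)
    (hg : Measurable g) (hYg : Integrable (fun z : ℝ × ℝ => z.2 * g z.1) P) :
    ∫ z, z.2 * g z.1 ∂P = ∫ x, f x * g x ∂P.fst := by
  have hm : MeasurableSpace.comap (Prod.fst : ℝ × ℝ → ℝ) inferInstance ≤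
      (inferInstance : MeasurableSpace (ℝ × ℝ)) := measurable_fst.comap_le
  have hgX : StronglyMeasurable[MeasurableSpace.comap (Prod.fst : ℝ × ℝ → ℝ) inferInstance]
      fun z : ℝ × ℝ => g z.1 := (hg.comp (comap_measurable _)).stronglyMeasurable
  calc ∫ z, z.2 * g z.1 ∂P
      = ∫ z, (P[fun z => z.2 * g z.1 | MeasurableSpace.comap Prod.fst inferInstance]) z ∂P :=
        (integral_condExp hm).symm
    _ = ∫ z, f z.1 * g z.1 ∂P := by
        refine integral_congr_ae ?_
        filter_upwards [condExp_mul_of_stronglyMeasurable_right hgX hYg hY, hf.2] with z hpull hfz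
        exact hpull.trans (by rw [Pi.mul_apply, ← hfz])
    _ = ∫ x, f x * g x ∂P.fst :=
        (integral_map measurable_fst.aemeasurable (hf.1.mul hg).aestronglyMeasurable).symm

lemma integral_snd_mul_sq_le (hY : ∀ᵐ z ∂P, |z.2| ≤ K) (hg : Measurable g)
    (hg2 : Integrable (fun x => g x ^ 2) P.fst) :
    ∫ z, (z.2 * g z.1) ^ 2 ∂P ≤ K ^ 2 * ∫ x, g x ^ 2 ∂P.fst := by
  have hmap : ∫ x, g x ^ 2 ∂P.fst = ∫ z, g z.1 ^ 2 ∂P :=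
    integral_map measurable_fst.aemeasurable (hg.pow_const 2).aestronglyMeasurable
  rw [hmap, ← integral_const_mul]
  refine integral_mono_of_nonneg (.of_forall fun _ => sq_nonneg _)
    ((hg2.comp_measurable measurable_fst).const_mul _) ?_
  filter_upwards [hY] with z hz
  rw [mul_pow]
  exact mul_le_mul_of_nonneg_right (sq_le_sq.2 (hz.trans (le_abs_self K))) (sq_nonneg _)

end Regression

namespace IsWarpedSystem

variable {φ ψ f : ℝ → ℝ} {P : Measure (ℝ × ℝ)} [IsProbabilityMeasure P] {B K : ℝ}
  {a : Option (ℕ × ℕ)} {n : ℕ}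

lemma measure_empCoeff_sub_coeff_ge_le (h : IsWarpedSystem φ ψ P.fst B)
    (hf : IsRegressionFunction P f) (hY : ∀ᵐ z ∂P, |z.2| ≤ K) (hK : 0 < K) (hB : 0 < B)
    (ha : IsIndex a) {u : ℝ} (hu : 0 ≤ u) (hn : n ≠ 0) :
    (Measure.pi fun _ : Fin n => P) {z | u ≤ |empCoeff φ ψ P.fst z a - coeff φ ψ P.fst f a|}
      ≤ ENNReal.ofReal (2 * Real.exp (-(n * min (u ^ 2 / (4 * K ^ 2))
          (u / (2 * (K * (B * (2 : ℝ) ^ ((level a : ℝ) / 2)))))))) := by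
  have hw := h.measurable a
  have hg : Measurable fun z : ℝ × ℝ => z.2 * warped φ ψ P.fst a z.1 :=
    measurable_snd.mul (hw.comp measurable_fst)
  have hbound : ∀ᵐ z ∂P, |z.2 * warped φ ψ P.fst a z.1|
      ≤ K * (B * (2 : ℝ) ^ ((level a : ℝ) / 2)) := by
    filter_upwards [hY] with z hz
    rw [abs_mul]
    exact mul_le_mul hz (h.abs_le a ha _) (abs_nonneg _) hK.le
  have hmean : ∫ z, z.2 * warped φ ψ P.fst a z.1 ∂P = coeff φ ψ P.fst f a :=
    hf.integral_snd_mul (.of_bound measurable_snd.aestronglyMeasurable K hY) hw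
      (.of_bound hg.aestronglyMeasurable _ hbound)
  have hvar : ∫ z, (z.2 * warped φ ψ P.fst a z.1) ^ 2 ∂P ≤ K ^ 2 := by
    refine (integral_snd_mul_sq_le hY hw (h.memLp_warped ha 2).integrable_sq).trans_eq ?_
    have hnorm := h.orthonormal a a ha ha
    rw [if_pos rfl] at hnorm
    simp only [sq (warped φ ψ P.fst a _), hnorm, mul_one]
  have hb0 : 0 < K * (B * (2 : ℝ) ^ ((level a : ℝ) / 2)) := by positivity
  have hbern := measure_pi_abs_mean_sub_integral_ge_le_exp hg hbound hvar hb0 (pow_pos hK 2) hu hn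
  rwa [hmean] at hbern

end IsWarpedSystem

section Calibration

variable {A B K b κ γ : ℝ} {n : ℕ}

lemma mul_log_le_gaussian_exponent (hK : 0 < K) (hκ : 64 * K ^ 2 * b ≤ κ ^ 2) (hn : 2 ≤ n) :
    b * Real.log n ≤ n * ((threshold κ n / 4) ^ 2 / (4 * K ^ 2)) := by
  calc b * Real.log n = 64 * K ^ 2 * b * Real.log n / (64 * K ^ 2) := by field_simp
    _ ≤ κ ^ 2 * Real.log n / (64 * K ^ 2) := by gcongr
    _ = n * ((threshold κ n / 4) ^ 2 / (4 * K ^ 2)) := by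
        rw [← mul_threshold_sq hn]
        ring

lemma mul_log_le_exponential_exponent (hA : 0 < A) (hκ1 : 1 ≤ κ) (hκ : 8 * A * b ≤ κ)
    (hγ : 1 / 2 ≤ γ) (hn : 2 ≤ n) {j : ℕ} (hj : j ≤ truncLevel γ (threshold κ n)) :
    b * Real.log n ≤ n * (threshold κ n / 4 / (2 * (A * (2 : ℝ) ^ ((j : ℝ) / 2)))) := by
  have hlam : 0 < threshold κ n := threshold_pos (by linarith) hn
  have : 0 < min (threshold κ n) 1 := lt_min hlam one_pos
  have hlevel : (2 : ℝ) ^ ((j : ℝ) / 2) * min (threshold κ n) 1 ≤ 1 := by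
    refine le_trans ?_ (two_rpow_half_truncLevel_mul_le hγ hlam)
    gcongr
    exact one_le_two
  have hthreshold : min (threshold κ n) 1 * threshold κ n
      ≤ threshold κ n / (2 : ℝ) ^ ((j : ℝ) / 2) := by
    rw [le_div_iff₀ (by positivity), mul_right_comm, mul_comm (min _ _)]
    exact mul_le_of_le_one_left hlam.le hlevel
  calc b * Real.log n = 8 * A * b * Real.log n / (8 * A) := by field_simp
    _ ≤ κ * Real.log n / (8 * A) := by gcongr
    _ ≤ n * (min (threshold κ n) 1 * threshold κ n) / (8 * A) :=
        div_le_div_of_nonneg_right (mul_log_le_mul_threshold hκ1 hn) (by positivity)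
    _ ≤ n * (threshold κ n / (2 : ℝ) ^ ((j : ℝ) / 2)) / (8 * A) := by gcongr
    _ = n * (threshold κ n / 4 / (2 * (A * (2 : ℝ) ^ ((j : ℝ) / 2)))) := by
        field_simp
        norm_num

lemma mul_log_le_bernstein_exponent (hK : 1 ≤ K) (hB : 1 ≤ B) (hb : 1 ≤ b)
    (hκ : 64 * K ^ 2 * B * b ≤ κ) (hγ : 1 / 2 ≤ γ) (hn : 2 ≤ n) {j : ℕ}
    (hj : j ≤ truncLevel γ (threshold κ n)) :
    b * Real.log n ≤ n * min ((threshold κ n / 4) ^ 2 / (4 * K ^ 2))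
      (threshold κ n / 4 / (2 * (K * (B * (2 : ℝ) ^ ((j : ℝ) / 2))))) := by
  have hKb : 1 ≤ K ^ 2 * b := one_le_mul_of_one_le_of_one_le (one_le_pow₀ hK) hb
  have hKBb : 64 * K ^ 2 * b ≤ κ := by nlinarith
  have hκ1 : 1 ≤ κ := by linarith
  have hlinear : 8 * (K * B) * b ≤ κ := by
    refine le_trans ?_ hκ
    have hKK : K ≤ K ^ 2 := le_self_pow₀ hK two_ne_zero
    rw [← mul_assoc]
    gcongr
    norm_num
  rw [mul_min_of_nonneg _ _ n.cast_nonneg, ← mul_assoc K]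
  exact le_min
    (mul_log_le_gaussian_exponent (by linarith) (hKBb.trans (le_self_pow₀ hκ1 two_ne_zero)) hn)
    (mul_log_le_exponential_exponent (by positivity) hκ1 hlinear hγ hn hj)

variable {φ ψ f : ℝ → ℝ} {P : Measure (ℝ × ℝ)} [IsProbabilityMeasure P]

lemma IsWarpedSystem.measure_not_coeffsWithin_le (h : IsWarpedSystem φ ψ P.fst B)
    (hf : IsRegressionFunction P f) (hY : ∀ᵐ z ∂P, |z.2| ≤ K) (hK : 1 ≤ K) (hB : 1 ≤ B)
    (hb : 1 ≤ b) (hκ : 64 * K ^ 2 * B * b ≤ κ) (hγ : 1 / 2 ≤ γ) (hn : 2 ≤ n) :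
    (Measure.pi fun _ : Fin n => P) {z | ¬ CoeffsWithin (coeff φ ψ P.fst f)
        (empCoeff φ ψ P.fst z) (threshold κ n / 4) (truncLevel γ (threshold κ n))}
      ≤ ENNReal.ofReal (4 * (n : ℝ) ^ (1 - b)) := by
  have hn0 : (0 : ℝ) < n := by positivity
  have hκ2 : 2 ≤ κ := by
    nlinarith [one_le_mul_of_one_le_of_one_le (one_le_mul_of_one_le_of_one_le
      (one_le_pow₀ hK : 1 ≤ K ^ 2) hB) hb]
  have hlam : 0 < threshold κ n := threshold_pos (by linarith) hn
  set J := truncLevel γ (threshold κ n)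
  have hone : ∀ a ∈ treeIndices (levelTree J), (Measure.pi fun _ : Fin n => P)
      {z | threshold κ n / 4 ≤ |empCoeff φ ψ P.fst z a - coeff φ ψ P.fst f a|}
        ≤ ENNReal.ofReal (2 * (n : ℝ) ^ (-b)) := by
    intro a ha
    refine (h.measure_empCoeff_sub_coeff_ge_le hf hY (by linarith) (by linarith)
      (isIndex_of_mem_treeIndices ha) (by positivity) (by omega)).trans
      (ENNReal.ofReal_le_ofReal ?_)
    rw [Real.rpow_def_of_pos hn0, mul_neg, mul_comm (Real.log n)]
    exact mul_le_mul_of_nonneg_left (Real.exp_le_exp.2 (neg_le_neg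
      (mul_log_le_bernstein_exponent hK hB hb hκ hγ hn (level_le_of_mem_treeIndices ha))))
      two_pos.le
  calc _ ≤ (Measure.pi fun _ : Fin n => P) (⋃ a ∈ treeIndices (levelTree J),
        {z | threshold κ n / 4 ≤ |empCoeff φ ψ P.fst z a - coeff φ ψ P.fst f a|}) := by
        refine measure_mono fun z hz => ?_
        obtain ⟨a, ha, hlt⟩ := by simpa [CoeffsWithin] using hz
        exact Set.mem_biUnion ha hlt.le
    _ ≤ ∑ a ∈ treeIndices (levelTree J), ENNReal.ofReal (2 * (n : ℝ) ^ (-b)) :=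
        (measure_biUnion_finset_le _ _).trans (Finset.sum_le_sum hone)
    _ = ENNReal.ofReal (2 ^ (J + 1) * (2 * (n : ℝ) ^ (-b))) := by
        rw [Finset.sum_const, card_treeIndices_levelTree, ← ENNReal.ofReal_nsmul, nsmul_eq_mul]
        push_cast
        rfl
    _ ≤ ENNReal.ofReal (4 * (n : ℝ) ^ (1 - b)) := by
        refine ENNReal.ofReal_le_ofReal ?_
        rw [sub_eq_add_neg, Real.rpow_add hn0, Real.rpow_one, pow_succ]
        nlinarith [two_pow_truncLevel_threshold_le hγ hκ2 hn, Real.rpow_nonneg hn0.le (-b)]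

end Calibration

/-! ### Risk of the estimator -/

lemma lintegral_sq_le_of_le_off {Ω : Type*} [MeasurableSpace Ω] {μ : Measure Ω}
    [IsProbabilityMeasure μ] {E : Ω → ℝ≥0∞} {G D : ℝ≥0∞} {bad : Set Ω}
    (hG : ∀ ω ∉ bad, E ω ≤ G) (hD : ∀ᵐ ω ∂μ, E ω ≤ D) :
    ∫⁻ ω, E ω ^ 2 ∂μ ≤ G ^ 2 + D ^ 2 * μ bad := by
  have hpoint : ∀ᵐ ω ∂μ, E ω ^ 2 ≤ G ^ 2 + bad.indicator (fun _ => D ^ 2) ω := by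
    filter_upwards [hD] with ω hω
    by_cases hbad : ω ∈ bad
    · rw [Set.indicator_of_mem hbad]
      exact le_add_of_le_right (pow_le_pow_left₀ zero_le hω 2)
    · exact le_add_of_le_left (pow_le_pow_left₀ zero_le (hG ω hbad) 2)
  refine (lintegral_mono_ae hpoint).trans ?_
  rw [lintegral_add_left measurable_const, lintegral_const, measure_univ, mul_one]
  gcongr
  exact lintegral_indicator_const_le _ _

lemma IsSparse.exists_sqrt_sum_le {d : Option (ℕ × ℕ) → ℝ} {s κ C : ℝ}
    (hd : IsSparse d (s + 1 / 2)⁻¹ C) (hs : 0 < s) (hκ : 0 < κ) :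
    ∃ c : ℝ, 0 < c ∧ ∀ n : ℕ, 2 ≤ n → ∀ (d' : Option (ℕ × ℕ) → ℝ) (J : ℕ),
      CoeffsWithin d d' (threshold κ n / 4) J →
      √(∑ p ∈ levelTree J \ thresholdTree d' (threshold κ n) J, residual d p ^ 2
          + ∑ a ∈ treeIndices (thresholdTree d' (threshold κ n) J), (d' a - d a) ^ 2)
        ≤ c * (Real.log n / n) ^ (s / (2 * s + 1)) := by
  have hC : 0 ≤ C := le_trans (by positivity) (hd 1 one_pos).2
  have hq : (s + 1 / 2)⁻¹ < 2 := by
    rw [inv_lt_comm₀ (by positivity) two_pos]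
    linarith
  have hrpow := fun n => threshold_rpow (n := n) hs hκ.le
  generalize (s + 1 / 2)⁻¹ = q at hd hq hrpow
  set A := C * (2 ^ (3 - q) / (2 - q) + 2 ^ q)
  have : 0 ≤ A := mul_nonneg hC (add_nonneg
    (div_nonneg (by positivity) (by linarith)) (by positivity))
  refine ⟨√(A * κ ^ (2 - q) + κ ^ 2), by positivity, fun n hn d' J h => ?_⟩
  set R := (Real.log n / n) ^ (s / (2 * s + 1))
  have hlam : 0 < threshold κ n := threshold_pos hκ hn
  have hlamR : threshold κ n ≤ κ * R := threshold_le hs hκ.le hn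
  have : 0 < R := Real.rpow_pos_of_pos (log_div_pos hn) _
  refine Real.sqrt_le_iff.2 ⟨by positivity, ?_⟩
  calc _ ≤ A * threshold κ n ^ (2 - q) + threshold κ n ^ 2 :=
        hd.sum_residual_sq_add_sum_sq_sub_le hq hlam h
    _ ≤ A * (κ ^ (2 - q) * R ^ 2) + (κ * R) ^ 2 := by
        rw [hrpow n hn]
        gcongr
    _ = (√(A * κ ^ (2 - q) + κ ^ 2) * R) ^ 2 := by
        rw [mul_pow √_, Real.sq_sqrt (by positivity)]
        ring

namespace IsWarpedSystem

variable {φ ψ f : ℝ → ℝ} {μ : Measure ℝ} {A B K γ κ s : ℝ} {n : ℕ}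

lemma eLpNorm_treeSum_le [IsFiniteMeasure μ] (h : IsWarpedSystem φ ψ μ B) (hA : 0 ≤ A)
    {d : Option (ℕ × ℕ) → ℝ} {J : ℕ} {T : Finset (ℕ × ℕ)} (hT : T ⊆ levelTree J)
    (hd : ∀ a ∈ treeIndices (levelTree J), |d a| ≤ A * (2 : ℝ) ^ ((level a : ℝ) / 2)) :
    eLpNorm (treeSum φ ψ μ d T) 2 μ ≤ ENNReal.ofReal (2 * A * 2 ^ J) := by
  have hsub := treeIndices_mono hT
  have hsq : ∀ a ∈ treeIndices (levelTree J), d a ^ 2 ≤ A ^ 2 * 2 ^ J := by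
    intro a ha
    calc d a ^ 2 ≤ (A * (2 : ℝ) ^ ((level a : ℝ) / 2)) ^ 2 :=
          sq_le_sq' (neg_le_of_abs_le (hd a ha)) (le_of_abs_le (hd a ha))
      _ = A ^ 2 * 2 ^ level a := by rw [mul_pow, two_rpow_half_sq]
      _ ≤ A ^ 2 * 2 ^ J := by
          gcongr
          · exact one_le_two
          · exact level_le_of_mem_treeIndices ha
  rw [funext (treeSum_eq_sum φ ψ μ d T),
    h.eLpNorm_sum_mul_warped fun a ha => isIndex_of_mem_treeIndices (hsub ha)]
  refine ENNReal.ofReal_le_ofReal (Real.sqrt_le_iff.2 ⟨by positivity, ?_⟩)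
  calc ∑ a ∈ treeIndices T, d a ^ 2
      ≤ ∑ a ∈ treeIndices (levelTree J), d a ^ 2 :=
        Finset.sum_le_sum_of_subset_of_nonneg hsub fun _ _ _ => sq_nonneg _
    _ ≤ 2 ^ (J + 1) * (A ^ 2 * 2 ^ J) := by
        refine (Finset.sum_le_card_nsmul _ _ _ hsq).trans_eq ?_
        rw [card_treeIndices_levelTree, nsmul_eq_mul]
        push_cast
        rfl
    _ ≤ (2 * A * 2 ^ J) ^ 2 := by
        rw [pow_succ]
        nlinarith [sq_nonneg (A * 2 ^ J)]

lemma abs_empCoeff_le (h : IsWarpedSystem φ ψ μ B) (hK : 0 ≤ K) {z : Fin n → ℝ × ℝ}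
    (hz : ∀ i, |(z i).2| ≤ K) {a : Option (ℕ × ℕ)} (ha : IsIndex a) :
    |empCoeff φ ψ μ z a| ≤ K * B * (2 : ℝ) ^ ((level a : ℝ) / 2) := by
  have hterm : ∀ i, |(z i).2 * warped φ ψ μ a (z i).1|
      ≤ K * B * (2 : ℝ) ^ ((level a : ℝ) / 2) := by
    intro i
    rw [abs_mul, mul_assoc]
    exact mul_le_mul (hz i) (h.abs_le a ha _) (abs_nonneg _) hK
  have hbound0 : 0 ≤ K * B * (2 : ℝ) ^ ((level a : ℝ) / 2) := by
    rw [mul_assoc]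
    exact mul_nonneg hK ((abs_nonneg _).trans (h.abs_le a ha 0))
  rw [empCoeff, abs_mul, abs_of_nonneg (by positivity)]
  calc (n : ℝ)⁻¹ * |∑ i, (z i).2 * warped φ ψ μ a (z i).1|
      ≤ (n : ℝ)⁻¹ * (n * (K * B * (2 : ℝ) ^ ((level a : ℝ) / 2))) := by
        gcongr
        refine (Finset.abs_sum_le_sum_abs _ _).trans
          ((Finset.sum_le_card_nsmul _ _ _ fun i _ => hterm i).trans_eq ?_)
        rw [Finset.card_univ, Fintype.card_fin, nsmul_eq_mul]
    _ ≤ K * B * (2 : ℝ) ^ ((level a : ℝ) / 2) := by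
        rw [← mul_assoc]
        exact mul_le_of_le_one_left hbound0 (inv_mul_le_one)

lemma eLpNorm_sub_estimator_le [IsFiniteMeasure μ] (h : IsWarpedSystem φ ψ μ B)
    (hf : MemLp f 2 μ) (hB : 0 ≤ B) (hK : 0 ≤ K) (hγ : 1 / 2 ≤ γ) (hκ : 2 ≤ κ) (hn : 2 ≤ n)
    {z : Fin n → ℝ × ℝ} (hz : ∀ i, |(z i).2| ≤ K) :
    eLpNorm (fun x => f x - estimator φ ψ μ κ γ z x) 2 μ
      ≤ ENNReal.ofReal (((eLpNorm f 2 μ).toReal + 2 * (K * B)) * n) := by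
  have hn1 : (1 : ℝ) ≤ n := by exact_mod_cast (by omega : 1 ≤ n)
  have hsum : eLpNorm (estimator φ ψ μ κ γ z) 2 μ
      ≤ ENNReal.ofReal (2 * (K * B) * 2 ^ truncLevel γ (threshold κ n)) :=
    h.eLpNorm_treeSum_le (by positivity) (thresholdTree_subset _ _ _) fun a ha =>
      h.abs_empCoeff_le hK hz (isIndex_of_mem_treeIndices ha)
  rw [add_mul, ENNReal.ofReal_add (by positivity) (by positivity)]
  refine (eLpNorm_sub_le hf.1 (h.measurable_treeSum _ _).aestronglyMeasurable one_le_two).trans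
    (add_le_add ?_ (hsum.trans (ENNReal.ofReal_le_ofReal ?_)))
  · exact (ENNReal.ofReal_toReal hf.2.ne).ge.trans
      (ENNReal.ofReal_le_ofReal (le_mul_of_one_le_right ENNReal.toReal_nonneg hn1))
  · gcongr
    exact two_pow_truncLevel_threshold_le hγ hκ hn

lemma exists_eLpNorm_sub_estimator_le [IsFiniteMeasure μ] (h : IsWarpedSystem φ ψ μ B)
    (hγ : 0 < γ) (hκ : 0 < κ) (hs : 0 < s) (hA : MemA φ ψ μ γ f) (hB : MemB φ ψ μ s f) :
    ∃ c : ℝ, 0 < c ∧ ∀ n : ℕ, 2 ≤ n → ∀ z : Fin n → ℝ × ℝ,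
      CoeffsWithin (coeff φ ψ μ f) (empCoeff φ ψ μ z) (threshold κ n / 4)
        (truncLevel γ (threshold κ n)) →
      eLpNorm (fun x => f x - estimator φ ψ μ κ γ z x) 2 μ
        ≤ ENNReal.ofReal (c * (Real.log n / n) ^ (s / (2 * s + 1))) := by
  obtain ⟨hf, M₀, hM₀⟩ := hA
  obtain ⟨-, C, hC⟩ := hB
  have hsparse : IsSparse (coeff φ ψ μ f) (s + 1 / 2)⁻¹ C := hC
  obtain ⟨c, hc, hthreshold⟩ := hsparse.exists_sqrt_sum_le hs hκ
  refine ⟨|M₀| * (2 ^ γ * κ) + c, by positivity, fun n hn z hz => ?_⟩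
  have : 0 < Real.log n / n := log_div_pos hn
  refine (h.eLpNorm_sub_treeSum_le hf.1 (thresholdTree_subset _ _ _) (coeff φ ψ μ f) _).trans ?_
  rw [add_mul, ENNReal.ofReal_add (by positivity) (by positivity)]
  refine add_le_add ((hM₀ _).trans (ENNReal.ofReal_le_ofReal ?_))
    (ENNReal.ofReal_le_ofReal (hthreshold n hn _ _ hz))
  calc M₀ * (2 : ℝ) ^ (-(truncLevel γ (threshold κ n) * γ))
      ≤ |M₀| * (2 ^ γ * threshold κ n) := mul_le_mul (le_abs_self _)
        (two_rpow_neg_truncLevel_le hγ (threshold_pos hκ hn)) (by positivity) (abs_nonneg _)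
    _ ≤ |M₀| * (2 ^ γ * (κ * (Real.log n / n) ^ (s / (2 * s + 1)))) := by
        gcongr
        exact threshold_le hs hκ.le hn
    _ = |M₀| * (2 ^ γ * κ) * (Real.log n / n) ^ (s / (2 * s + 1)) := by ring

end IsWarpedSystem

section Risk

variable {φ ψ f : ℝ → ℝ} {P : Measure (ℝ × ℝ)} [IsProbabilityMeasure P] {B K b c γ κ s : ℝ}
  {n : ℕ}

lemma ae_pi_abs_snd_le (hY : ∀ᵐ z ∂P, |z.2| ≤ K) :
    ∀ᵐ z ∂(Measure.pi fun _ : Fin n => P), ∀ i, |(z i).2| ≤ K :=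
  ae_all_iff.2 fun i => (measurePreserving_eval (fun _ => P) i).quasiMeasurePreserving.ae hY

lemma IsWarpedSystem.lintegral_eLpNorm_sub_estimator_sq_le (h : IsWarpedSystem φ ψ P.fst B)
    (hf : MemLp f 2 P.fst) (hY : ∀ᵐ z ∂P, |z.2| ≤ K) (hB : 0 ≤ B) (hK : 0 ≤ K)
    (hγ : 1 / 2 ≤ γ) (hκ : 2 ≤ κ) (hb : 4 ≤ b) (hs : 0 < s) (hn : 2 ≤ n) (hc : 0 ≤ c)
    {bad : Set (Fin n → ℝ × ℝ)}
    (hgood : ∀ z ∉ bad, eLpNorm (fun x => f x - estimator φ ψ P.fst κ γ z x) 2 P.fst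
      ≤ ENNReal.ofReal (c * (Real.log n / n) ^ (s / (2 * s + 1))))
    (hbad : (Measure.pi fun _ : Fin n => P) bad ≤ ENNReal.ofReal (4 * (n : ℝ) ^ (1 - b))) :
    ∫⁻ z, eLpNorm (fun x => f x - estimator φ ψ P.fst κ γ z x) 2 P.fst ^ 2
        ∂(Measure.pi fun _ : Fin n => P)
      ≤ ENNReal.ofReal ((c ^ 2 + 8 * ((eLpNorm f 2 P.fst).toReal + 2 * (K * B)) ^ 2)
          * (Real.log n / n) ^ (2 * s / (2 * s + 1))) := by
  set D := (eLpNorm f 2 P.fst).toReal + 2 * (K * B)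
  have hn0 : (0 : ℝ) < n := by positivity
  have hx : 0 < Real.log n / n := log_div_pos hn
  have hcrude : ∀ᵐ z ∂(Measure.pi fun _ : Fin n => P),
      eLpNorm (fun x => f x - estimator φ ψ P.fst κ γ z x) 2 P.fst ≤ ENNReal.ofReal (D * n) := by
    filter_upwards [ae_pi_abs_snd_le hY] with z hz
    exact h.eLpNorm_sub_estimator_le hf hB hK hγ hκ hn hz
  have hrate : ((Real.log n / n) ^ (s / (2 * s + 1))) ^ 2
      = (Real.log n / n) ^ (2 * s / (2 * s + 1)) := by
    rw [← Real.rpow_mul_natCast hx.le]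
    congr 1
    push_cast
    ring
  have hpow : (n : ℝ) ^ 2 * (n : ℝ) ^ (1 - b) ≤ (n : ℝ) ^ (-1 : ℝ) := by
    rw [← Real.rpow_two, ← Real.rpow_add hn0]
    exact Real.rpow_le_rpow_of_exponent_le (by exact_mod_cast (by omega : 1 ≤ n)) (by linarith)
  refine (lintegral_sq_le_of_le_off hgood hcrude).trans
    ((add_le_add le_rfl (mul_le_mul le_rfl hbad zero_le zero_le)).trans ?_)
  rw [← ENNReal.ofReal_pow (by positivity), ← ENNReal.ofReal_pow (by positivity),
    ← ENNReal.ofReal_mul (by positivity), ← ENNReal.ofReal_add (by positivity) (by positivity)]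
  refine ENNReal.ofReal_le_ofReal ?_
  calc _ = c ^ 2 * (Real.log n / n) ^ (2 * s / (2 * s + 1))
        + 4 * D ^ 2 * ((n : ℝ) ^ 2 * (n : ℝ) ^ (1 - b)) := by rw [mul_pow, hrate]; ring
    _ ≤ c ^ 2 * (Real.log n / n) ^ (2 * s / (2 * s + 1))
        + 4 * D ^ 2 * (2 * (Real.log n / n) ^ (2 * s / (2 * s + 1))) := by
        exact add_le_add le_rfl
          (mul_le_mul_of_nonneg_left (hpow.trans (rpow_neg_one_le hs hn)) (by positivity))
    _ = _ := by ring

end Risk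

end WarpedWavelet

open WarpedWavelet

theorem theorem2_general (φ ψ : ℝ → ℝ) (hψ : IsOrthonormalWavelet φ ψ)
    (M β γ : ℝ) (hγ : 1 / 2 ≤ γ) :
    ∃ κ : ℝ, 0 < κ ∧
      ∀ (P : Measure (ℝ × ℝ)) [IsProbabilityMeasure P] [NullSingletonClass P.fst] (f : ℝ → ℝ),
        (∀ᵐ z ∂P, |z.2| ≤ M) →
        IsRegressionFunction P f →
        ∀ s : ℝ, 0 < s →
          MemA φ ψ P.fst γ f →
          MemB φ ψ P.fst s f →
          ∃ c C : ℝ, 0 < c ∧ 0 < C ∧ ∀ n : ℕ, 2 ≤ n →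
            (Measure.pi fun _ : Fin n => P)
                {z | ENNReal.ofReal (c * (Real.log n / n) ^ (s / (2 * s + 1))) <
                  eLpNorm (fun x => f x - estimator φ ψ P.fst κ γ z x) 2 P.fst}
              ≤ ENNReal.ofReal (C * (n : ℝ) ^ (-β)) ∧
            ∫⁻ z, eLpNorm (fun x => f x - estimator φ ψ P.fst κ γ z x) 2 P.fst ^ 2
                ∂(Measure.pi fun _ : Fin n => P)
              ≤ ENNReal.ofReal (C * (Real.log n / n) ^ (2 * s / (2 * s + 1))) := by
  obtain ⟨B, hB, hsys⟩ := hψ.exists_isWarpedSystem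
  obtain ⟨K, hK, hMK⟩ : ∃ K : ℝ, 1 ≤ K ∧ M ≤ K := ⟨max 1 M, le_max_left _ _, le_max_right _ _⟩
  obtain ⟨b, hb, hbβ⟩ : ∃ b : ℝ, 4 ≤ b ∧ 1 - b ≤ -β :=
    ⟨max 4 (β + 1), le_max_left _ _, by linarith [le_max_right 4 (β + 1)]⟩
  obtain ⟨κ, hκ, hκ2⟩ : ∃ κ : ℝ, 64 * K ^ 2 * B * b ≤ κ ∧ 2 ≤ κ :=
    ⟨max _ 2, le_max_left _ _, le_max_right _ _⟩
  refine ⟨κ, by linarith, fun P _ _ f hY hf s hs hA hBs => ?_⟩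
  have hYK : ∀ᵐ z ∂P, |z.2| ≤ K := hY.mono fun z hz => hz.trans hMK
  obtain ⟨c, hc, hgood⟩ := (hsys P.fst).exists_eLpNorm_sub_estimator_le (κ := κ)
    (by linarith) (by linarith) hs hA hBs
  have hbad := fun n hn => (hsys P.fst).measure_not_coeffsWithin_le (n := n) hf hYK hK hB
    (by linarith) hκ hγ hn
  set D := (eLpNorm f 2 P.fst).toReal + 2 * (K * B)
  refine ⟨c, max 4 (c ^ 2 + 8 * D ^ 2), hc, by positivity, fun n hn => ⟨?_, ?_⟩⟩
  · refine (measure_mono fun z hz hgoodz => not_lt.2 (hgood n hn z hgoodz) hz).trans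
      ((hbad n hn).trans (ENNReal.ofReal_le_ofReal ?_))
    have hn1 : (1 : ℝ) ≤ n := by exact_mod_cast (by omega : 1 ≤ n)
    gcongr
    exact le_max_left _ _
  · refine ((hsys P.fst).lintegral_eLpNorm_sub_estimator_sq_le hA.1 hYK (by linarith)
      (by linarith) hγ hκ2 hb hs hn hc.le (fun z hz => hgood n hn z (not_not.1 hz))
      (hbad n hn)).trans (ENNReal.ofReal_le_ofReal ?_)
    have := log_div_pos hn
    exact mul_le_mul_of_nonneg_right (le_max_right _ _) (by positivity)

theorem theorem2 (φ ψ : ℝ → ℝ) (hψ : WarpedWavelet.IsWaveletBasis φ ψ)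
    (M β γ : ℝ) (hγ : 1 / 2 ≤ γ) :
    ∃ κ : ℝ, 0 < κ ∧
      ∀ (P : Measure (ℝ × ℝ)) [IsProbabilityMeasure P] [NullSingletonClass P.fst] (f : ℝ → ℝ),
        (∀ᵐ z ∂P, z.1 ∈ Set.Icc (0 : ℝ) 1 ∧ z.2 ∈ Set.Icc (-M) M) →
        WarpedWavelet.IsRegressionFunction P f →
        ∀ s : ℝ, 0 < s →
          WarpedWavelet.MemA φ ψ P.fst γ f →
          WarpedWavelet.MemB φ ψ P.fst s f →
          ∃ c C : ℝ, 0 < c ∧ 0 < C ∧ ∀ n : ℕ, 2 ≤ n →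
            (Measure.pi fun _ : Fin n => P)
                {z | ENNReal.ofReal (c * (Real.log n / n) ^ (s / (2 * s + 1))) <
                  eLpNorm (fun x => f x - WarpedWavelet.estimator φ ψ P.fst κ γ z x) 2 P.fst}
              ≤ ENNReal.ofReal (C * (n : ℝ) ^ (-β)) ∧
            ∫⁻ z, eLpNorm (fun x => f x - WarpedWavelet.estimator φ ψ P.fst κ γ z x) 2 P.fst ^ 2
                ∂(Measure.pi fun _ : Fin n => P)
              ≤ ENNReal.ofReal (C * (Real.log n / n) ^ (2 * s / (2 * s + 1))) := by
  obtain ⟨κ, hκ, hrisk⟩ := theorem2_general φ ψ hψ.isOrthonormalWavelet M β γ hγ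
  exact ⟨κ, hκ, fun P _ _ f hP => hrisk P f (hP.mono fun z hz => abs_le.2 hz.2)⟩
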